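/- Let $D_i=(x_i^L,x_i^R)$, $1\le i\le N$, be disjoint intervals with $x_i^L<x_i^R<x_{i+1}^L$, and put $D=\bigcup_i D_i$, $\ell_i=x_i^R-x_i^L$, $s_i=x_{i+1}^L-x_i^R$, $V=\mathrm{diag}(\ell_1,\dots,\ell_N)$. Let $\gamma\in\mathbb R\setminus\{0\}$, $v>0$, $v_b>0$. For $k\in\mathbb C$ not of the form $n\pi/s_i$ with $n\in\mathbb Z\setminus\{0\}$, and boundary data $f=(f_i^{L},f_i^{R})_{1\le i\le N}\in\mathbb C^{2N}$, let $w$ be the unique solution on $\mathbb R\setminus D$ of $w''+k^2w=0$ with $w(x_i^{L})=f_i^{L}$, $w(x_i^{R})=f_i^{R}$ and the radiation condition $\frac{dw}{d|x|}-ikw=0$ on the two unbounded components, that is, $-w'-ikw=0$ on $(-\infty,x_1^L)$ and $w'-ikw=0$ on $(x_N^R,\infty)$. The Dirichlet-to-Neumann map is $\mathcal T^k[f]_i^{L}=-w'(x_i^{L})$, $\mathcal T^k[f]_i^{R}=w'(x_i^{R})$ (one-sided derivatives from outside $D$). For $\omega\in\mathbb C$, $\delta\in\mathbb R$ near $0$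 and $u,w$ in the complex Sobolev space $H^1(D)$ put $$a_{\omega,\delta}(u,w)=\sum_{i=1}^N\Big(\int_{D_i}(u'\bar w'-\gamma u'\bar w)\,dx+\int_{D_i}u\,dx\int_{D_i}\bar w\,dx\Big)-\sum_{i=1}^N\Big(\int_{D_i}\frac{\omega^2}{v_b^2}u\bar w\,dx+\delta\big(\bar w(x_i^R)\mathcal T^{\omega/v}[u]_i^R+\bar w(x_i^L)\mathcal T^{\omega/v}[u]_i^L\big)\Big),$$ where $\mathcal T^{\omega/v}$ is applied to the boundary values of $u$. Let $V_j:\mathbb R\to\mathbb R$ be the continuous function, bounded as $|x|\to\infty$, with $V_j''=0$ on $\mathbb R\setminus D$ and $V_j=\delta_{ij}$ (Kronecker symbol) on $D_i$ for every $i$. The gauge capacitance matrix $\mathcal C^\gamma\in\mathbb R^{N\times N}$ is $$\mathcal C^\gamma_{ij}=-\frac{\ell_i}{\int_{D_i}e^{\gamma x}\,dx}\Big(e^{\gamma x_i^R}V_j'(x_i^R)-e^{\gamma x_i^L}V_j'(x_i^L)\Big),$$ with derivatives taken from outside $D$. Then there are $\varepsilon>0$ and $K$, depending only on the intervals, $\gamma$,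 $v$ and $v_b$, such that for all $\omega\in\mathbb C$ and $\delta\in\mathbb R$ with $|\omega|<\varepsilon$ and $|\delta|<\varepsilon$ the following holds. For each $1\le j\le N$ there is a unique $h_j(\omega,\delta)\in H^1(D)$ with $$a_{\omega,\delta}(h_j(\omega,\delta),w)=\int_{D_j}\bar w\,dx\qquad\text{for all }w\in H^1(D),$$ and the matrix $\mathcal C(\omega,\delta)=\big(\int_{D_i}h_j(\omega,\delta)\,dx\big)_{i,j}$ satisfies $$\mathcal C(\omega,\delta)=I+\frac{\omega^2}{v_b^2}V^{-1}-\delta\,V^{-1}\mathcal C^\gamma V^{-1}+R(\omega,\delta),\qquad |R_{ij}(\omega,\delta)|\le K(|\omega|+|\delta|)^2\ \text{ for all } i,j.$$ -/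

import Mathlib

open MeasureTheory Set

/-- A chain of `N` disjoint intervals `D_i = (xL i, xR i)` (the resonators) on the real line,
numbered from left to right. -/
structure ResonatorChain (N : ℕ) where
  /-- left endpoints -/
  xL : Fin N → ℝ
  /-- right endpoints -/
  xR : Fin N → ℝ
  left_lt_right : ∀ i, xL i < xR i
  right_lt_left : ∀ i j, i < j → xR i < xL j

namespace ResonatorChain

variable {N : ℕ} (c : ResonatorChain N)

/-- The length `ℓ_i` of the `i`-th resonator. -/
def len (i : Fin N) : ℝ := c.xR i - c.xL i

/-- The union `D` of the (open) resonators. -/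
def D : Set ℝ := ⋃ i, Ioo (c.xL i) (c.xR i)

/-- The closed set `ℝ \ D`. It is a finite union of closed intervals of positive length, so that
`derivWithin w c.exterior` is the ordinary derivative of `w` inside these intervals, and the
one-sided derivative taken from outside `D` at the endpoints `xL i`, `xR i`. -/
def exterior : Set ℝ := (c.D)ᶜ

/-- `w` solves the outer problem with wave number `k` and boundary data `f` (`Sum.inl i` is the
left endpoint of the `i`-th resonator, `Sum.inr i` its right endpoint): `w'' + k² w = 0` on
`ℝ \ D`, `w = f` at the endpoints, and `dw/d|x| - i k w = 0` to the left and to the right of the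
whole chain. Nothing is required of `w` inside the resonators. -/
structure IsOuterSolution (k : ℂ) (f : Fin N ⊕ Fin N → ℂ) (w : ℝ → ℂ) : Prop where
  differentiable : DifferentiableOn ℝ w c.exterior
  differentiable' : DifferentiableOn ℝ (derivWithin w c.exterior) c.exterior
  helmholtz : ∀ x ∈ c.exterior,
    derivWithin (derivWithin w c.exterior) c.exterior x + k ^ 2 * w x = 0
  left : ∀ i, w (c.xL i) = f (Sum.inl i)
  right : ∀ i, w (c.xR i) = f (Sum.inr i)
  radiation_left : ∀ x, (∀ i, x < c.xL i) →
    -derivWithin w c.exterior x - Complex.I * k * w x = 0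
  radiation_right : ∀ x, (∀ i, c.xR i < x) →
    derivWithin w c.exterior x - Complex.I * k * w x = 0

/-- The Dirichlet-to-Neumann map `T^k`: the boundary data `f` are sent to the derivatives
`-w'(xL i)` and `w'(xR i)`, taken from outside `D`, of the solution `w` of the outer problem.
That solution exists and is unique on `ℝ \ D` as soon as `k` is not one of the numbers `nπ / s_i`
(`n` a nonzero integer, `s_i` the distance between two consecutive resonators), in particular for
all `k` near `0`; for the other `k` the value below has no meaning. -/
noncomputable def dtn (k : ℂ) (f : Fin N ⊕ Fin N → ℂ) : Fin N ⊕ Fin N → ℂ :=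
  Sum.elim
    (fun i => -derivWithin (Classical.epsilon (c.IsOuterSolution k f)) c.exterior (c.xL i))
    (fun i => derivWithin (Classical.epsilon (c.IsOuterSolution k f)) c.exterior (c.xR i))

/-- An element of the complex Sobolev space `H¹(D)`: a function in `L²(D)` with a weak derivative
in `L²(D)`, given through its representative that is continuous up to the endpoints of each
resonator (in dimension one each class has exactly one), so that its traces at the endpoints are
its values there. Values of `toFun` outside the closed intervals `[xL i, xR i]` and values of
`weakDeriv` on null sets are irrelevant. -/
structure SobolevH1 where
  toFun : ℝ → ℂ
  weakDeriv : ℝ → ℂ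
  continuousOn : ∀ i, ContinuousOn toFun (Icc (c.xL i) (c.xR i))
  memLp : MemLp toFun 2 (volume.restrict c.D)
  memLp_weakDeriv : MemLp weakDeriv 2 (volume.restrict c.D)
  isWeakDeriv : ∀ φ : ℝ → ℝ, ContDiff ℝ (⊤ : ℕ∞) φ → HasCompactSupport φ → tsupport φ ⊆ c.D →
    ∫ x in c.D, deriv φ x • toFun x = -∫ x in c.D, φ x • weakDeriv x

variable {c}

/-- The traces of an element of `H¹(D)` at all endpoints. -/
def SobolevH1.trace (u : c.SobolevH1) : Fin N ⊕ Fin N → ℂ :=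
  Sum.elim (fun i => u.toFun (c.xL i)) (fun i => u.toFun (c.xR i))

variable (c)

/-- The form `a_{ω,δ}(u, w)` on `H¹(D)`, linear in `u` and antilinear in `w`; `γ` is the gauge
potential, `v` and `vb` are the wave speeds outside and inside the resonators. -/
noncomputable def form (γ v vb : ℝ) (ω : ℂ) (δ : ℝ) (u w : c.SobolevH1) : ℂ :=
  ∑ i, ((∫ x in c.xL i..c.xR i,
          (u.weakDeriv x * star (w.weakDeriv x) - γ * u.weakDeriv x * star (w.toFun x)))
        + (∫ x in c.xL i..c.xR i, u.toFun x) * (∫ x in c.xL i..c.xR i, star (w.toFun x)))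
  - ∑ i, ((∫ x in c.xL i..c.xR i, ω ^ 2 / vb ^ 2 * u.toFun x * star (w.toFun x))
        + δ * (star (w.toFun (c.xR i)) * c.dtn (ω / v) u.trace (Sum.inr i)
              + star (w.toFun (c.xL i)) * c.dtn (ω / v) u.trace (Sum.inl i)))

/-- `h` solves the variational problem that defines `h_j(ω, δ)`:
`a_{ω,δ}(h, w) = ∫_{D_j} w̄` for all `w ∈ H¹(D)`. -/
def IsBasisFunction (γ v vb : ℝ) (ω : ℂ) (δ : ℝ) (j : Fin N) (h : c.SobolevH1) : Prop :=
  ∀ w : c.SobolevH1, c.form γ v vb ω δ h w = ∫ x in c.xL j..c.xR j, star (w.toFun x)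

/-- The matrix `(∫_{D_i} h_j)_{i,j}` of a family `h_1, …, h_N` in `H¹(D)`. -/
noncomputable def integralMatrix (h : Fin N → c.SobolevH1) : Matrix (Fin N) (Fin N) ℂ :=
  Matrix.of fun i j => ∫ x in c.xL i..c.xR i, (h j).toFun x

/-- `V` is the potential `V_j`: it is `1` on the `j`-th resonator and `0` on the others (up to the
endpoints, as `V` is continuous), `V'' = 0` on `ℝ \ D`, and `V(x) = O(1)` as `|x| → ∞`. -/
structure IsPotential (j : Fin N) (V : ℝ → ℝ) : Prop where
  eq_one : ∀ x ∈ Icc (c.xL j) (c.xR j), V x = 1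
  eq_zero : ∀ i, i ≠ j → ∀ x ∈ Icc (c.xL i) (c.xR i), V x = 0
  differentiable : DifferentiableOn ℝ V c.exterior
  differentiable' : DifferentiableOn ℝ (derivWithin V c.exterior) c.exterior
  laplace : ∀ x ∈ c.exterior, derivWithin (derivWithin V c.exterior) c.exterior x = 0
  bounded : V =O[Bornology.cobounded ℝ] (fun _ => (1 : ℝ))

/-- The potential `V_j`; there is exactly one function with `IsPotential j`. -/
noncomputable def potential (j : Fin N) : ℝ → ℝ := Classical.epsilon (c.IsPotential j)

/-- The gauge capacitance matrix
`C^γ_{ij} = - (|D_i| / ∫_{D_i} e^{γx} dx) ∫_{∂D_i} e^{γx} ∂V_j/∂ν dσ`. The boundary `∂D_i` consists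
of the two endpoints; the outward normal derivative, taken from outside `D`, is `V_j'` at `xR i`
and `-V_j'` at `xL i`. -/
noncomputable def gaugeCapacitance (γ : ℝ) : Matrix (Fin N) (Fin N) ℝ :=
  Matrix.of fun i j =>
    -(c.len i / ∫ x in c.xL i..c.xR i, Real.exp (γ * x)) *
      (Real.exp (γ * c.xR i) * derivWithin (c.potential j) c.exterior (c.xR i)
        + Real.exp (γ * c.xL i) * -derivWithin (c.potential j) c.exterior (c.xL i))

/-- The volume matrix `V = diag(ℓ_1, …, ℓ_N)`. -/
def volumeMatrix : Matrix (Fin N) (Fin N) ℂ := Matrix.diagonal fun i => (c.len i : ℂ)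

end ResonatorChain

/-!
Write `κ = ω² / vb²`, `Eᵢ = ∫_{Dᵢ} exp (γ x) dx`, `mᵢ = ∫_{Dᵢ} u` and `T` for the
Dirichlet-to-Neumann map with wave number `ω / v`. Consider a solution `u` of
`a(u, w) = ∑ᵢ Fᵢ ∫_{Dᵢ} w̄`. No general theory of sesquilinear forms is needed, because two families
of explicit test functions supported on one resonator already determine `u` up to small terms.

* For `w(x) = exp (γ x)` one has `w' - γ w = 0`, the terms with `u'` drop out, and
  `(mᵢ - Fᵢ) Eᵢ = κ ∫_{Dᵢ} u exp (γ x) + δ (exp (γ xᵢᴿ) T[u]ᵢᴿ + exp (γ xᵢᴸ) T[u]ᵢᴸ)`.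
* If `w` solves `w' - γ w = 1_{(-∞, x]}` with `w(xᵢᴸ) = 0`, the terms with `u'` give
  `u(x) - u(xᵢᴸ)`.

These identities are recorded in `ResonatorChain.IsIntegralSolution`. Since `κ` and `δ` are small,
they show that `u` is within `O((|κ| + |δ|) sup |u|)` of the constant `Fᵢ / ℓᵢ` on `Dᵢ`
(`exists_local_bound`), hence that `sup |u|` is bounded by `|F|`, and that `u = 0` if `F = 0`
(`exists_uniform_bound`). That is uniqueness. Inserting `u ≈ 1 / ℓⱼ` on `Dⱼ`, `u ≈ 0` on the other
resonators, and `T ≈ T⁰` into the first identity gives the coefficient of `δ`, because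
`T⁰` maps the traces of the indicator function of `Dⱼ` to the outward derivatives of the potential
`Vⱼ` (`IsIntegralSolution.norm_integral_sub_le`). The term `ω² / vb² V⁻¹` is itself of second order,
so it is absorbed by the error bound.

Existence follows from uniqueness by a dimension count (`exists_form_eq`): on each resonator a
solution is sought in the three-dimensional space of functions for which `-u'' - γ u' - κ u` is
constant, and there are three linear conditions, the value of the constant and the two boundary
conditions.

The outer problem is solved explicitly in each component of `ℝ \ D`. A Wronskian identity gives
uniqueness, so `dtn k` is the linear map `dtnMap k`, whose entries are differentiable in `k` at `0`
(`exists_dtn_bounds`). Integration by parts with boundary terms for elements of `H¹(D)` is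
derived from the definition of the weak derivative by cutoffs
(`SobolevH1.setIntegral_smul_weakDeriv`).
-/

open scoped Topology

/-! ### Cutoffs and integration by parts in `H¹(D)` -/

section cutoff
open Filter Real

lemma deriv_smoothTransition_eq_zero {x : ℝ} (hx : x ∉ Icc (0 : ℝ) 1) :
    deriv smoothTransition x = 0 := by
  rw [mem_Icc, not_and_or, not_le, not_le] at hx
  rcases hx with hx | hx
  · have : smoothTransition =ᶠ[𝓝 x] fun _ => 0 := by
      filter_upwards [Iio_mem_nhds hx] with y hy using smoothTransition.zero_of_nonpos (le_of_lt hy)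
    rw [this.deriv_eq, deriv_const]
  · have : smoothTransition =ᶠ[𝓝 x] fun _ => 1 := by
      filter_upwards [Ioi_mem_nhds hx] with y hy using smoothTransition.one_of_one_le (le_of_lt hy)
    rw [this.deriv_eq, deriv_const]

lemma continuous_deriv_smoothTransition : Continuous (deriv smoothTransition) :=
  (smoothTransition.contDiff (n := 1)).continuous_deriv le_rfl

lemma hasCompactSupport_deriv_smoothTransition : HasCompactSupport (deriv smoothTransition) :=
  HasCompactSupport.intro isCompact_Icc fun _ hx => deriv_smoothTransition_eq_zero hx

lemma integral_deriv_smoothTransition : ∫ x, deriv smoothTransition x = 1 := by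
  have h1 : ∫ x in (0 : ℝ)..1, deriv smoothTransition x = 1 := by
    rw [intervalIntegral.integral_deriv_eq_sub]
    · simp
    · exact fun x _ => ((smoothTransition.contDiff (n := 1)).differentiable (by simp)) x
    · exact continuous_deriv_smoothTransition.intervalIntegrable _ _
  rw [← h1, intervalIntegral.integral_of_le zero_le_one, ← integral_Icc_eq_integral_Ioc,
    setIntegral_eq_integral_of_forall_compl_eq_zero]
  exact fun x hx => deriv_smoothTransition_eq_zero hx

/-- The derivatives of the steps `t ↦ smoothTransition (n (t - p) - r)` form an approximate
identity at `p`. -/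
lemma tendsto_integral_deriv_step (p r : ℝ) {F : ℝ → ℂ} (hF : Continuous F) {B : ℝ}
    (hB : ∀ x, ‖F x‖ ≤ B) :
    Tendsto (fun n : ℕ => ∫ t, ((n : ℝ) * deriv smoothTransition (n * (t - p) - r)) • F t)
      atTop (𝓝 (F p)) := by
  have key : ∀ᶠ n : ℕ in atTop,
      ∫ s, deriv smoothTransition s • F (p + (s + r) * (n : ℝ)⁻¹)
        = ∫ t, ((n : ℝ) * deriv smoothTransition (n * (t - p) - r)) • F t := by
    filter_upwards [eventually_gt_atTop 0] with n hn
    have hn' : (0 : ℝ) < n := by exact_mod_cast hn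
    have e1 : (fun t => ((n : ℝ) * deriv smoothTransition (n * (t - p) - r)) • F t)
        = fun t => (fun y => (n : ℝ) • (fun s => deriv smoothTransition s •
            F (p + (s + r) * (n : ℝ)⁻¹)) (y - (n * p + r))) (n * t) := by
      funext t
      have h1 : (n : ℝ) * (t - p) - r = n * t - (n * p + r) := by ring
      have h2 : p + ((n : ℝ) * t - (n * p + r) + r) * (n : ℝ)⁻¹ = t := by field_simp; ring
      simp only [h1, h2, mul_smul]
    rw [e1, Measure.integral_comp_mul_left (fun y => (n : ℝ) • (fun s =>
      deriv smoothTransition s • F (p + (s + r) * (n : ℝ)⁻¹)) (y - (n * p + r))), integral_smul, integral_sub_right_eq_self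
      (fun s => deriv smoothTransition s • F (p + (s + r) * (n : ℝ)⁻¹)), smul_smul,
      abs_of_pos (by positivity), inv_mul_cancel₀ hn'.ne', one_smul]
  refine Tendsto.congr' key ?_
  have hlim : (∫ s, deriv smoothTransition s • F p) = F p := by
    rw [integral_smul_const, integral_deriv_smoothTransition, one_smul]
  rw [← hlim]
  refine tendsto_integral_of_dominated_convergence
    (fun s => ‖deriv smoothTransition s‖ * B) ?_ ?_ ?_ ?_
  · intro n
    refine Continuous.aestronglyMeasurable ?_
    exact continuous_deriv_smoothTransition.smul (hF.comp (by fun_prop))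
  · exact (continuous_deriv_smoothTransition.integrable_of_hasCompactSupport
      hasCompactSupport_deriv_smoothTransition).norm.mul_const _
  · intro n
    refine .of_forall fun s => ?_
    rw [norm_smul]
    exact mul_le_mul_of_nonneg_left (hB _) (norm_nonneg _)
  · refine .of_forall fun s => Tendsto.const_smul ?_ _
    have : Tendsto (fun n : ℕ => p + (s + r) * (n : ℝ)⁻¹) atTop (𝓝 (p + (s + r) * 0)) :=
      (tendsto_inv_atTop_nhds_zero_nat.const_mul _).const_add _
    rw [mul_zero, add_zero] at this
    exact (hF.tendsto p).comp this

/-- A smooth cutoff that vanishes near and outside the endpoints of `(p, q)` and tends to the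
indicator function of `(p, q)` as `n → ∞`. -/
noncomputable def cutoff (p q : ℝ) (n : ℕ) (t : ℝ) : ℝ :=
  smoothTransition (n * (t - p) - 1) - smoothTransition (n * (t - q) - (-2))

lemma contDiff_cutoff (p q : ℝ) (n : ℕ) : ContDiff ℝ (⊤ : ℕ∞) (cutoff p q n) := by
  unfold cutoff
  exact (smoothTransition.contDiff.comp (by fun_prop)).sub
    (smoothTransition.contDiff.comp (by fun_prop))

lemma abs_cutoff_le (p q : ℝ) (n : ℕ) (t : ℝ) : |cutoff p q n t| ≤ 1 := by
  unfold cutoff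
  have h1 := smoothTransition.le_one (n * (t - p) - 1)
  have h2 := smoothTransition.nonneg (n * (t - p) - 1)
  have h3 := smoothTransition.le_one (n * (t - q) - (-2))
  have h4 := smoothTransition.nonneg (n * (t - q) - (-2))
  rw [abs_le]; constructor <;> linarith

lemma hasDerivAt_cutoff (p q : ℝ) (n : ℕ) (t : ℝ) :
    HasDerivAt (cutoff p q n) (n * deriv smoothTransition (n * (t - p) - 1)
      - n * deriv smoothTransition (n * (t - q) - (-2))) t := by
  have hd : Differentiable ℝ smoothTransition :=
    (smoothTransition.contDiff (n := 1)).differentiable (by simp)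
  have h (a r : ℝ) : HasDerivAt (fun t => smoothTransition (n * (t - a) - r))
      (n * deriv smoothTransition (n * (t - a) - r)) t := by
    have h1 : HasDerivAt (fun t : ℝ => (n : ℝ) * (t - a) - r) n t := by
      simpa using (((hasDerivAt_id t).sub_const a).const_mul (n : ℝ)).sub_const r
    simpa [mul_comm, Function.comp_def] using
      HasDerivAt.comp t (hd (n * (t - a) - r)).hasDerivAt h1
  exact (h p 1).sub (h q (-2))

lemma cutoff_eq_zero {p q : ℝ} {n : ℕ} (hn : 3 ≤ n * (q - p)) {t : ℝ}
    (ht : n * (t - p) < 1 ∨ n * (q - t) < 1) : cutoff p q n t = 0 := by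
  unfold cutoff
  rcases ht with ht | ht
  · rw [smoothTransition.zero_of_nonpos (by linarith),
      smoothTransition.zero_of_nonpos (by linarith), sub_zero]
  · rw [smoothTransition.one_of_one_le (by linarith),
      smoothTransition.one_of_one_le (by linarith), sub_self]

lemma tendsto_cutoff {p q t : ℝ} (hp : p < t) (hq : t < q) :
    Tendsto (fun n : ℕ => cutoff p q n t) atTop (𝓝 1) := by
  refine tendsto_const_nhds.congr' ?_
  have h1 := (tendsto_natCast_atTop_atTop (R := ℝ)).atTop_mul_const (sub_pos.2 hp)
  have h2 := (tendsto_natCast_atTop_atTop (R := ℝ)).atTop_mul_const (sub_pos.2 hq)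
  filter_upwards [h1.eventually_ge_atTop 2, h2.eventually_ge_atTop 2] with n h3 h4
  unfold cutoff
  rw [smoothTransition.one_of_one_le (by linarith),
    smoothTransition.zero_of_nonpos (by linarith), sub_zero]

end cutoff

namespace ResonatorChain
variable {N : ℕ} {c : ResonatorChain N}

lemma Ioo_subset_D (c : ResonatorChain N) (i : Fin N) : Ioo (c.xL i) (c.xR i) ⊆ c.D :=
  subset_iUnion (fun i => Ioo (c.xL i) (c.xR i)) i

lemma measurableSet_D (c : ResonatorChain N) : MeasurableSet c.D :=
  MeasurableSet.iUnion fun _ => measurableSet_Ioo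

namespace SobolevH1

lemma memLp_toFun_restrict (u : c.SobolevH1) (i : Fin N) {p q : ℝ} (hp : c.xL i ≤ p)
    (hq : q ≤ c.xR i) : MemLp u.toFun 2 (volume.restrict (Ioo p q)) :=
  u.memLp.mono_measure (Measure.restrict_mono
    ((Ioo_subset_Ioo hp hq).trans (c.Ioo_subset_D i)) le_rfl)

lemma memLp_weakDeriv_restrict (u : c.SobolevH1) (i : Fin N) {p q : ℝ} (hp : c.xL i ≤ p)
    (hq : q ≤ c.xR i) : MemLp u.weakDeriv 2 (volume.restrict (Ioo p q)) :=
  u.memLp_weakDeriv.mono_measure (Measure.restrict_mono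
    ((Ioo_subset_Ioo hp hq).trans (c.Ioo_subset_D i)) le_rfl)

open Filter Real in
/-- Integration by parts against a smooth function on a closed subinterval of a resonator, boundary
terms included. The defining identity is applied to the products of `φ` with cutoffs. -/
lemma setIntegral_smul_weakDeriv (u : c.SobolevH1) (i : Fin N) {p q : ℝ} (hp : c.xL i ≤ p)
    (hpq : p < q) (hq : q ≤ c.xR i) {φ : ℝ → ℝ} (hφ : ContDiff ℝ (⊤ : ℕ∞) φ) :
    ∫ x in Ioo p q, φ x • u.weakDeriv x = φ q • u.toFun q - φ p • u.toFun p
      - ∫ x in Ioo p q, deriv φ x • u.toFun x := by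
  have hsub : Ioo p q ⊆ c.D := (Ioo_subset_Ioo hp hq).trans (c.Ioo_subset_D i)
  have hcont : ContinuousOn u.toFun (Icc p q) := (u.continuousOn i).mono (Icc_subset_Icc hp hq)
  have hφd : Continuous (deriv φ) := hφ.continuous_deriv (by simp)
  -- the product `φ u` on `[p, q]`, extended continuously by constants
  set F : ℝ → ℂ := fun t => φ (projIcc p q hpq.le t) • u.toFun (projIcc p q hpq.le t) with hFdef
  have hF : Continuous F := by
    have : ContinuousOn (fun t => φ t • u.toFun t) (Icc p q) := hφ.continuous.continuousOn.smul hcont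
    exact this.comp_continuous (continuous_subtype_val.comp continuous_projIcc)
      (fun t => (projIcc p q hpq.le t).2)
  have hFeq : ∀ t ∈ Icc p q, F t = φ t • u.toFun t := by
    intro t ht; simp only [hFdef, projIcc_of_mem hpq.le ht]
  obtain ⟨B, hB⟩ : ∃ B, ∀ x, ‖F x‖ ≤ B := by
    have : ContinuousOn (fun t => φ t • u.toFun t) (Icc p q) := hφ.continuous.continuousOn.smul hcont
    obtain ⟨B, hB⟩ := isCompact_Icc.exists_bound_of_continuousOn this
    exact ⟨B, fun x => hB _ (projIcc p q hpq.le x).2⟩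
  have hIu : IntegrableOn u.toFun (Ioo p q) := (u.memLp_toFun_restrict i hp hq).integrable (by norm_num)
  have hIw : IntegrableOn u.weakDeriv (Ioo p q) :=
    (u.memLp_weakDeriv_restrict i hp hq).integrable (by norm_num)
  obtain ⟨B1, hB1⟩ := isCompact_Icc.exists_bound_of_continuousOn
    (hφ.continuous.continuousOn (s := Icc p q))
  obtain ⟨B2, hB2⟩ := isCompact_Icc.exists_bound_of_continuousOn
    (hφd.continuousOn (s := Icc p q))
  have hlim (g : ℝ → ℂ) (ψ : ℝ → ℝ) (hg : IntegrableOn g (Ioo p q)) (hψ : Continuous ψ) (B : ℝ)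
      (hB : ∀ x ∈ Icc p q, ‖ψ x‖ ≤ B) :
      Tendsto (fun n => ∫ x in Ioo p q, (cutoff p q n x * ψ x) • g x) atTop
        (𝓝 (∫ x in Ioo p q, ψ x • g x)) := by
    refine tendsto_integral_of_dominated_convergence (fun x => B * ‖g x‖) ?_ ?_ ?_ ?_
    · intro n
      exact (((contDiff_cutoff p q n).continuous.mul hψ).aestronglyMeasurable).smul
        hg.aestronglyMeasurable
    · exact hg.norm.const_mul B
    · intro n
      filter_upwards [ae_restrict_mem measurableSet_Ioo] with x hx
      rw [norm_smul, norm_mul]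
      have h1 : ‖cutoff p q n x‖ ≤ 1 := abs_cutoff_le p q n x
      have h2 := hB x (Ioo_subset_Icc_self hx)
      gcongr
      calc _ ≤ 1 * B := by gcongr
        _ = B := one_mul _
    · filter_upwards [ae_restrict_mem measurableSet_Ioo] with x hx
      have := ((tendsto_cutoff hx.1 hx.2).mul_const (ψ x)).smul_const (g x)
      simpa using this
  -- the definition of the weak derivative, for the test function `cutoff p q n * φ`
  have hid : ∀ᶠ n : ℕ in atTop,
      (∫ x in Ioo p q, (cutoff p q n x * deriv φ x) • u.toFun x)
        + ((∫ t, ((n : ℝ) * deriv smoothTransition (n * (t - p) - 1)) • F t)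
          - ∫ t, ((n : ℝ) * deriv smoothTransition (n * (t - q) - (-2))) • F t)
      = - ∫ x in Ioo p q, (cutoff p q n x * φ x) • u.weakDeriv x := by
    have h3 := (tendsto_natCast_atTop_atTop (R := ℝ)).atTop_mul_const (sub_pos.2 hpq)
    filter_upwards [h3.eventually_ge_atTop 3, eventually_gt_atTop 0] with n hn hn0
    have hn0' : (0 : ℝ) < n := by exact_mod_cast hn0
    have hsupp : ∀ t, t ∉ Icc (p + (n : ℝ)⁻¹) (q - (n : ℝ)⁻¹) → cutoff p q n t = 0 := by
      intro t ht
      apply cutoff_eq_zero hn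
      rw [mem_Icc, not_and_or, not_le, not_le] at ht
      refine ht.imp (fun h => ?_) (fun h => ?_)
      · have : t - p < (n : ℝ)⁻¹ := by linarith
        calc (n : ℝ) * (t - p) < n * (n : ℝ)⁻¹ := by gcongr
          _ = 1 := mul_inv_cancel₀ hn0'.ne'
      · have : q - t < (n : ℝ)⁻¹ := by linarith
        calc (n : ℝ) * (q - t) < n * (n : ℝ)⁻¹ := by gcongr
          _ = 1 := mul_inv_cancel₀ hn0'.ne'
    have hcl : Icc (p + (n : ℝ)⁻¹) (q - (n : ℝ)⁻¹) ⊆ Ioo p q := fun t ht =>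
      ⟨lt_of_lt_of_le (by simpa using hn0) ht.1,
        lt_of_le_of_lt ht.2 (by simpa using hn0)⟩
    have hts : tsupport (fun t => cutoff p q n t * φ t) ⊆
        Icc (p + (n : ℝ)⁻¹) (q - (n : ℝ)⁻¹) := by
      refine closure_minimal (fun t ht => ?_) isClosed_Icc
      by_contra h
      exact ht (by simp [hsupp t h])
    have hmain := u.isWeakDeriv (fun t => cutoff p q n t * φ t)
      ((contDiff_cutoff p q n).mul hφ)
      (isCompact_Icc.of_isClosed_subset (isClosed_tsupport _) hts)
      (hts.trans (hcl.trans hsub))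
    have hder : ∀ t, HasDerivAt (fun t => cutoff p q n t * φ t)
        ((n * deriv smoothTransition (n * (t - p) - 1)
          - n * deriv smoothTransition (n * (t - q) - (-2))) * φ t
          + cutoff p q n t * deriv φ t) t := fun t =>
      (hasDerivAt_cutoff p q n t).mul (hφ.differentiable (by simp) t).hasDerivAt
    have hr : ∫ x in c.D, (cutoff p q n x * φ x) • u.weakDeriv x
        = ∫ x in Ioo p q, (cutoff p q n x * φ x) • u.weakDeriv x := by
      refine setIntegral_eq_of_subset_of_forall_sdiff_eq_zero c.measurableSet_D hsub fun x hx => ?_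
      rw [hsupp x (fun h => hx.2 (hcl h)), zero_mul, zero_smul]
    have hdz : ∀ t ∉ Ioo p q, (n * deriv smoothTransition (n * (t - p) - 1)
        - n * deriv smoothTransition (n * (t - q) - (-2))) = 0 := by
      intro t ht
      have : cutoff p q n =ᶠ[𝓝 t] fun _ => 0 := by
        filter_upwards [isClosed_Icc.isOpen_compl.mem_nhds (fun h => ht (hcl h))] with y hy
          using hsupp y hy
      rw [← (hasDerivAt_cutoff p q n t).deriv, this.deriv_eq, deriv_const]
    have hl : ∫ x in c.D, deriv (fun t => cutoff p q n t * φ t) x • u.toFun x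
        = ∫ x in Ioo p q, (((n * deriv smoothTransition (n * (x - p) - 1)
          - n * deriv smoothTransition (n * (x - q) - (-2)))) • F x
          + (cutoff p q n x * deriv φ x) • u.toFun x) := by
      rw [setIntegral_eq_of_subset_of_forall_sdiff_eq_zero c.measurableSet_D hsub]
      · refine setIntegral_congr_fun measurableSet_Ioo fun x hx => ?_
        rw [(hder x).deriv, hFeq x (Ioo_subset_Icc_self hx), add_smul, smul_smul]
      · intro x hx
        rw [(hder x).deriv, hdz x hx.2, hsupp x (fun h => hx.2 (hcl h))]
        simp
    have hcS (a r : ℝ) : Continuous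
        (fun t : ℝ => ((n : ℝ) * deriv smoothTransition (n * (t - a) - r))) :=
      continuous_const.mul (continuous_deriv_smoothTransition.comp (by fun_prop))
    have hiS (a r : ℝ) : Integrable
        (fun t : ℝ => ((n : ℝ) * deriv smoothTransition (n * (t - a) - r)) • F t) := by
      refine ((hcS a r).smul hF).integrable_of_hasCompactSupport ?_
      refine HasCompactSupport.intro
        (isCompact_Icc (a := a + r / n) (b := a + (r + 1) / n)) fun x hx => ?_
      rw [Pi.smul_apply', deriv_smoothTransition_eq_zero, mul_zero, zero_smul]
      refine fun h => hx ⟨?_, ?_⟩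
      · rw [← le_sub_iff_add_le', div_le_iff₀ hn0']; linarith [h.1]
      · rw [← sub_le_iff_le_add', le_div_iff₀ hn0']; linarith [h.2]
    rw [hr, hl, integral_add] at hmain
    · rw [← hmain, add_comm, ← integral_sub (hiS _ _) (hiS _ _)]
      congr 1
      rw [setIntegral_eq_integral_of_forall_compl_eq_zero]
      · simp only [sub_smul]
      · intro x hx; rw [hdz x hx, zero_smul]
    · have := ((hiS p 1).sub (hiS q (-2))).integrableOn (s := Ioo p q)
      refine this.congr (.of_forall fun x => ?_)
      simp [sub_smul]
    · refine Integrable.bdd_smul (φ := fun x => cutoff p q n x * deriv φ x) hIu B2 ?_ ?_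
      · exact ((contDiff_cutoff p q n).continuous.mul hφd).aestronglyMeasurable
      · filter_upwards [ae_restrict_mem measurableSet_Ioo] with x hx
        rw [norm_mul]
        calc _ ≤ 1 * B2 := mul_le_mul (abs_cutoff_le p q n x) (hB2 x (Ioo_subset_Icc_self hx))
              (norm_nonneg _) zero_le_one
          _ = B2 := one_mul _
  have hL := ((hlim _ _ hIu hφd B2 hB2).add
    ((tendsto_integral_deriv_step p 1 hF hB).sub (tendsto_integral_deriv_step q (-2) hF hB)))
  have hR := (hlim _ _ hIw hφ.continuous B1 hB1).neg
  have := tendsto_nhds_unique (hL.congr' hid) hR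
  rw [hFeq p (left_mem_Icc.2 hpq.le), hFeq q (right_mem_Icc.2 hpq.le)] at this
  linear_combination this

end SobolevH1
end ResonatorChain

/-! ### Elements of `H¹(D)` given piecewise -/

namespace ResonatorChain
variable {N : ℕ} {c : ResonatorChain N}

lemma left_le_right (c : ResonatorChain N) (i : Fin N) : c.xL i ≤ c.xR i :=
  (c.left_lt_right i).le

lemma disjoint_Icc (c : ResonatorChain N) {i j : Fin N} (hij : i ≠ j) :
    Disjoint (Icc (c.xL i) (c.xR i)) (Icc (c.xL j) (c.xR j)) := by
  rw [Set.disjoint_left]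
  rintro x ⟨h1, h2⟩ ⟨h3, h4⟩
  rcases lt_or_gt_of_ne hij with h | h
  · have := c.right_lt_left i j h; linarith
  · have := c.right_lt_left j i h; linarith

lemma pairwise_disjoint_Ioo (c : ResonatorChain N) :
    Pairwise (Function.onFun Disjoint fun i => Ioo (c.xL i) (c.xR i)) := fun _ _ hij =>
  (c.disjoint_Icc hij).mono Ioo_subset_Icc_self Ioo_subset_Icc_self

lemma notMem_D_of_mem_Icc (c : ResonatorChain N) {i : Fin N} {x : ℝ}
    (hx : x ∈ Icc (c.xL i) (c.xR i)) (hx' : x ∉ Ioo (c.xL i) (c.xR i)) : x ∉ c.D := by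
  rw [D, mem_iUnion]
  rintro ⟨j, hj⟩
  by_cases hij : i = j
  · exact hx' (hij ▸ hj)
  · exact Set.disjoint_left.1 (c.disjoint_Icc hij) hx (Ioo_subset_Icc_self hj)

lemma xL_notMem_D (c : ResonatorChain N) (i : Fin N) : c.xL i ∉ c.D :=
  c.notMem_D_of_mem_Icc (left_mem_Icc.2 (c.left_le_right i)) (by simp)

lemma xR_notMem_D (c : ResonatorChain N) (i : Fin N) : c.xR i ∉ c.D :=
  c.notMem_D_of_mem_Icc (right_mem_Icc.2 (c.left_le_right i)) (by simp)

/-- `g` is continuous on `[a, b]`, differentiable in `(a, b)` off a countable set with derivative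
`g'`, and `g'` is square integrable. -/
structure IsPiece (a b : ℝ) (g g' : ℝ → ℂ) : Prop where
  continuousOn : ContinuousOn g (Icc a b)
  hasDerivAt : ∃ s : Set ℝ, s.Countable ∧ ∀ x ∈ Ioo a b \ s, HasDerivAt g (g' x) x
  memLp : MemLp g' 2 (volume.restrict (Icc a b))

lemma IsPiece.zero (a b : ℝ) : IsPiece a b 0 0 :=
  ⟨continuousOn_const, ⟨∅, countable_empty, fun x _ => hasDerivAt_const x 0⟩, MemLp.zero⟩

lemma memLp_two_of_continuousOn {a b : ℝ} {g : ℝ → ℂ} (hg : ContinuousOn g (Icc a b)) :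
    MemLp g 2 (volume.restrict (Icc a b)) := by
  obtain ⟨B, hB⟩ := isCompact_Icc.exists_bound_of_continuousOn hg
  refine MemLp.of_bound (hg.aestronglyMeasurable measurableSet_Icc) B ?_
  filter_upwards [ae_restrict_mem measurableSet_Icc] with x hx using hB x hx

lemma IsPiece.of_hasDerivAt {a b : ℝ} {g g' : ℝ → ℂ} (h : ∀ x, HasDerivAt g (g' x) x)
    (hc : Continuous g') : IsPiece a b g g' :=
  ⟨fun x _ => (h x).continuousAt.continuousWithinAt, ⟨∅, countable_empty, fun x _ => h x⟩,
    memLp_two_of_continuousOn hc.continuousOn⟩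

lemma IsPiece.integral_deriv_smul {a b : ℝ} (hab : a ≤ b) {g g' : ℝ → ℂ} (h : IsPiece a b g g')
    {φ : ℝ → ℝ} (hφ : ContDiff ℝ (⊤ : ℕ∞) φ) (ha : φ a = 0) (hb : φ b = 0) :
    ∫ x in Ioo a b, deriv φ x • g x = -∫ x in Ioo a b, φ x • g' x := by
  obtain ⟨s, hs, hd⟩ := h.hasDerivAt
  have hφd : Continuous (deriv φ) := hφ.continuous_deriv (by simp)
  have hI1 : IntegrableOn (fun x => deriv φ x • g x) (Icc a b) :=
    (hφd.continuousOn.smul h.continuousOn).integrableOn_Icc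
  have hI2 : IntegrableOn (fun x => φ x • g' x) (Icc a b) :=
    IntegrableOn.continuousOn_smul (h.memLp.integrable (by norm_num)) hφ.continuous.continuousOn
      isCompact_Icc
  have key := integral_eq_of_hasDerivAt_off_countable_of_le (fun x => φ x • g x)
    (fun x => φ x • g' x + deriv φ x • g x) hab hs
    (hφ.continuous.continuousOn.smul h.continuousOn)
    (fun x hx => (hφ.differentiable (by simp) x).hasDerivAt.smul (hd x hx))
    (by rw [intervalIntegrable_iff_integrableOn_Icc_of_le hab]; exact hI2.add hI1)
  rw [intervalIntegral.integral_of_le hab, ← integral_Icc_eq_integral_Ioc, integral_add hI2 hI1,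
    ha, hb, zero_smul, zero_smul, sub_zero, integral_Icc_eq_integral_Ioo,
    integral_Icc_eq_integral_Ioo] at key
  linear_combination key

lemma sum_indicator_eq (c : ResonatorChain N) (g : Fin N → ℝ → ℂ) {i : Fin N} {x : ℝ}
    (hx : x ∈ Icc (c.xL i) (c.xR i)) :
    ∑ j, (Icc (c.xL j) (c.xR j)).indicator (g j) x = g i x := by
  rw [Finset.sum_eq_single i, indicator_of_mem hx]
  · intro j _ hj
    exact indicator_of_notMem (Set.disjoint_right.1 (c.disjoint_Icc hj) hx) _
  · simp

lemma memLp_sum_indicator (c : ResonatorChain N) (g : Fin N → ℝ → ℂ)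
    (hg : ∀ i, MemLp (g i) 2 (volume.restrict (Icc (c.xL i) (c.xR i)))) :
    MemLp (fun x => ∑ j, (Icc (c.xL j) (c.xR j)).indicator (g j) x) 2 (volume.restrict c.D) := by
  refine memLp_finsetSum _ fun i _ => ?_
  exact ((memLp_indicator_iff_restrict measurableSet_Icc).2 (hg i)).restrict _

lemma setIntegral_D {f : ℝ → ℂ} (c : ResonatorChain N)
    (hf : ∀ i, IntegrableOn f (Ioo (c.xL i) (c.xR i))) :
    ∫ x in c.D, f x = ∑ i, ∫ x in Ioo (c.xL i) (c.xR i), f x :=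
  integral_iUnion_fintype (fun _ => measurableSet_Ioo) c.pairwise_disjoint_Ioo hf

/-- The element of `H¹(D)` that equals `g i` on the `i`-th resonator. -/
noncomputable def SobolevH1.ofPieces (g g' : Fin N → ℝ → ℂ)
    (h : ∀ i, IsPiece (c.xL i) (c.xR i) (g i) (g' i)) : c.SobolevH1 where
  toFun x := ∑ j, (Icc (c.xL j) (c.xR j)).indicator (g j) x
  weakDeriv x := ∑ j, (Icc (c.xL j) (c.xR j)).indicator (g' j) x
  continuousOn i := (h i).continuousOn.congr fun _ hx => c.sum_indicator_eq g hx
  memLp := c.memLp_sum_indicator g fun i => memLp_two_of_continuousOn (h i).continuousOn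
  memLp_weakDeriv := c.memLp_sum_indicator g' fun i => (h i).memLp
  isWeakDeriv φ hφ _ hs := by
    have hφd : Continuous (deriv φ) := hφ.continuous_deriv (by simp)
    have e1 (ψ : ℝ → ℝ) (f : Fin N → ℝ → ℂ) (i : Fin N) :
        EqOn (fun x => ψ x • ∑ j, (Icc (c.xL j) (c.xR j)).indicator (f j) x)
          (fun x => ψ x • f i x) (Ioo (c.xL i) (c.xR i)) := fun x hx => by
      beta_reduce
      rw [c.sum_indicator_eq f (Ioo_subset_Icc_self hx)]
    have hI (ψ : ℝ → ℝ) (hψ : Continuous ψ) (f : Fin N → ℝ → ℂ)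
        (hf : ∀ i, MemLp (f i) 2 (volume.restrict (Icc (c.xL i) (c.xR i)))) (i : Fin N) :
        IntegrableOn (fun x => ψ x • ∑ j, (Icc (c.xL j) (c.xR j)).indicator (f j) x)
          (Ioo (c.xL i) (c.xR i)) := by
      rw [integrableOn_congr_fun (e1 ψ f i) measurableSet_Ioo]
      exact (IntegrableOn.continuousOn_smul ((hf i).integrable (by norm_num)) hψ.continuousOn
        isCompact_Icc).mono_set
          Ioo_subset_Icc_self
    rw [c.setIntegral_D (hI _ hφd g fun i => memLp_two_of_continuousOn (h i).continuousOn),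
      c.setIntegral_D (hI _ hφ.continuous g' fun i => (h i).memLp), ← Finset.sum_neg_distrib]
    refine Finset.sum_congr rfl fun i _ => ?_
    rw [setIntegral_congr_fun measurableSet_Ioo (e1 _ g i),
      setIntegral_congr_fun measurableSet_Ioo (e1 _ g' i)]
    refine (h i).integral_deriv_smul (c.left_le_right i) hφ ?_ ?_
    · exact image_eq_zero_of_notMem_tsupport fun hx => c.xL_notMem_D i (hs hx)
    · exact image_eq_zero_of_notMem_tsupport fun hx => c.xR_notMem_D i (hs hx)

namespace SobolevH1

section ofPieces
variable {g g' : Fin N → ℝ → ℂ} (h : ∀ i, IsPiece (c.xL i) (c.xR i) (g i) (g' i))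

lemma ofPieces_toFun {i : Fin N} {x : ℝ} (hx : x ∈ Icc (c.xL i) (c.xR i)) :
    (ofPieces g g' h).toFun x = g i x := c.sum_indicator_eq g hx

lemma ofPieces_weakDeriv {i : Fin N} {x : ℝ} (hx : x ∈ Icc (c.xL i) (c.xR i)) :
    (ofPieces g g' h).weakDeriv x = g' i x := c.sum_indicator_eq g' hx

end ofPieces

lemma intervalIntegrable_weakDeriv (u : c.SobolevH1) (i : Fin N) :
    IntervalIntegrable u.weakDeriv volume (c.xL i) (c.xR i) := by
  rw [intervalIntegrable_iff_integrableOn_Ioo_of_le (c.left_le_right i)]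
  exact (u.memLp_weakDeriv_restrict i le_rfl le_rfl).integrable (by norm_num)

/-- Integration by parts against a smooth complex function on a closed subinterval of a
resonator. -/
lemma integral_mul_weakDeriv (u : c.SobolevH1) (i : Fin N) {p q : ℝ} (hp : c.xL i ≤ p)
    (hpq : p ≤ q) (hq : q ≤ c.xR i) {φ φ' : ℝ → ℂ} (hφ : ContDiff ℝ (⊤ : ℕ∞) φ)
    (hd : ∀ x, HasDerivAt φ (φ' x) x) :
    ∫ x in p..q, φ x * u.weakDeriv x = φ q * u.toFun q - φ p * u.toFun p
      - ∫ x in p..q, φ' x * u.toFun x := by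
  rcases hpq.eq_or_lt with rfl | hpq
  · simp
  have hφ' : Continuous φ' := by
    have : φ' = deriv φ := funext fun x => (hd x).deriv.symm
    rw [this]; exact hφ.continuous_deriv (by simp)
  have hre : ContDiff ℝ (⊤ : ℕ∞) (fun x => (φ x).re) := Complex.reCLM.contDiff.comp hφ
  have him : ContDiff ℝ (⊤ : ℕ∞) (fun x => (φ x).im) := Complex.imCLM.contDiff.comp hφ
  have hdre (x : ℝ) : deriv (fun x => (φ x).re) x = (φ' x).re :=
    (Complex.reCLM.hasFDerivAt.comp_hasDerivAt x (hd x)).deriv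
  have hdim (x : ℝ) : deriv (fun x => (φ x).im) x = (φ' x).im :=
    (Complex.imCLM.hasFDerivAt.comp_hasDerivAt x (hd x)).deriv
  have k1 := u.setIntegral_smul_weakDeriv i hp hpq hq hre
  have k2 := u.setIntegral_smul_weakDeriv i hp hpq hq him
  simp only [hdre, hdim] at k1 k2
  have hIu : ContinuousOn u.toFun (Icc p q) := (u.continuousOn i).mono (Icc_subset_Icc hp hq)
  have hIw : IntegrableOn u.weakDeriv (Ioo p q) :=
    (u.memLp_weakDeriv_restrict i hp hq).integrable (by norm_num)
  have hIw' : IntegrableOn u.weakDeriv (Icc p q) := by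
    rwa [integrableOn_Icc_iff_integrableOn_Ioo]
  have i1 (ψ : ℝ → ℝ) (hψ : Continuous ψ) :
      Integrable (fun x => ψ x • u.weakDeriv x) (volume.restrict (Ioo p q)) :=
    (IntegrableOn.continuousOn_smul hIw' hψ.continuousOn isCompact_Icc).mono_set Ioo_subset_Icc_self
  have i2 (ψ : ℝ → ℝ) (hψ : Continuous ψ) :
      Integrable (fun x => ψ x • u.toFun x) (volume.restrict (Ioo p q)) :=
    ((hψ.continuousOn.smul hIu).integrableOn_Icc).mono_set Ioo_subset_Icc_self
  have split (f : ℝ → ℂ) (y : ℝ → ℂ) (x : ℝ) :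
      f x * y x = (f x).re • y x + Complex.I * ((f x).im • y x) := by
    conv_lhs => rw [← Complex.re_add_im (f x)]
    simp only [Complex.real_smul]; ring
  rw [intervalIntegral.integral_of_le hpq.le, intervalIntegral.integral_of_le hpq.le,
    integral_Ioc_eq_integral_Ioo, integral_Ioc_eq_integral_Ioo]
  simp only [split φ u.weakDeriv, split φ' u.toFun, split φ u.toFun]
  rw [integral_add, integral_add, integral_const_mul, integral_const_mul, k1, k2]
  · ring
  · exact i2 _ (Complex.continuous_re.comp hφ')
  · exact (i2 _ (Complex.continuous_im.comp hφ')).const_mul _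
  · exact i1 _ hre.continuous
  · exact (i1 _ him.continuous).const_mul _

lemma integral_weakDeriv (u : c.SobolevH1) (i : Fin N) {x : ℝ}
    (hx : x ∈ Icc (c.xL i) (c.xR i)) :
    ∫ y in c.xL i..x, u.weakDeriv y = u.toFun x - u.toFun (c.xL i) := by
  simpa using u.integral_mul_weakDeriv i le_rfl hx.1 hx.2 (φ := fun _ => 1) (φ' := fun _ => 0)
    contDiff_const (fun x => hasDerivAt_const x 1)

end SobolevH1
end ResonatorChain

/-! ### The outer problem -/

section cells

/-- `S` is, locally around each of its points, all of `E`. For `E = ℝ \ D` this holds for the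
closed gaps between consecutive resonators and for the two unbounded components. -/
structure IsCell (E S : Set ℝ) : Prop where
  eventuallyEq : ∀ x ∈ S, E =ᶠ[𝓝 x] S
  uniqueDiffOn : UniqueDiffOn ℝ S

variable {E S : Set ℝ} {F : Type*} [NormedAddCommGroup F] [NormedSpace ℝ F]

lemma IsCell.subset (h : IsCell E S) : S ⊆ E := fun x hx =>
  ((h.eventuallyEq x hx).mem_iff.self_of_nhds).2 hx

lemma IsCell.hasDerivWithinAt_iff (h : IsCell E S) {f : ℝ → F} {f' : F} {x : ℝ} (hx : x ∈ S) :
    HasDerivWithinAt f f' E x ↔ HasDerivWithinAt f f' S x :=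
  hasDerivWithinAt_congr_set (h.eventuallyEq x hx)

lemma IsCell.uniqueDiffWithinAt (h : IsCell E S) {x : ℝ} (hx : x ∈ S) :
    UniqueDiffWithinAt ℝ E x :=
  (uniqueDiffWithinAt_congr (by
    rw [nhdsWithin_eq_iff_eventuallyEq]; exact h.eventuallyEq x hx)).2 (h.uniqueDiffOn x hx)

lemma IsCell.hasDerivWithinAt (h : IsCell E S) {f : ℝ → F} (hf : DifferentiableOn ℝ f E) {x : ℝ}
    (hx : x ∈ S) : HasDerivWithinAt f (derivWithin f E x) S x :=
  (h.hasDerivWithinAt_iff hx).1 (hf x (h.subset hx)).hasDerivWithinAt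

lemma IsCell.hasDerivWithinAt_of_eqOn (h : IsCell E S) {f φ φ' : ℝ → F} (hf : EqOn f φ S)
    (hφ : ∀ x, HasDerivAt φ (φ' x) x) {x : ℝ} (hx : x ∈ S) : HasDerivWithinAt f (φ' x) E x :=
  (h.hasDerivWithinAt_iff hx).2 ((hφ x).hasDerivWithinAt.congr_of_mem hf hx)

lemma IsCell.derivWithin_eqOn (h : IsCell E S) {f φ φ' : ℝ → F} (hf : EqOn f φ S)
    (hφ : ∀ x, HasDerivAt φ (φ' x) x) : EqOn (derivWithin f E) φ' S := fun _ hx =>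
  (h.hasDerivWithinAt_of_eqOn hf hφ hx).derivWithin (h.uniqueDiffWithinAt hx)

lemma Convex.eq_of_hasDerivWithinAt_zero (hS : Convex ℝ S) {f : ℝ → F}
    (hf : ∀ x ∈ S, HasDerivWithinAt f 0 S x) {x y : ℝ} (hx : x ∈ S) (hy : y ∈ S) : f x = f y := by
  have := hS.norm_image_sub_le_of_norm_hasDerivWithin_le (C := 0) hf (by simp) hy hx
  rwa [zero_mul, norm_le_zero_iff, sub_eq_zero] at this

end cells

section sinDiv

/-- `sin (k t) / k`, with the value `t` at `k = 0`: the solution of `y'' + k² y = 0`, `y(0) = 0`,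
`y'(0) = 1`. -/
noncomputable def sinDiv (k : ℂ) (t : ℝ) : ℂ := dslope (fun z => Complex.sin (z * t)) 0 k

lemma hasDerivAt_sin_mul (t : ℝ) (z : ℂ) :
    HasDerivAt (fun z => Complex.sin (z * t)) (Complex.cos (z * t) * t) z := by
  have h : HasDerivAt (fun z : ℂ => z * (t : ℂ)) (t : ℂ) z := by
    simpa using (hasDerivAt_id z).mul_const (t : ℂ)
  exact h.csin

@[simp] lemma sinDiv_zero_left (t : ℝ) : sinDiv 0 t = t := by
  rw [sinDiv, dslope_same, (hasDerivAt_sin_mul t 0).deriv]; simp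

lemma sinDiv_of_ne {k : ℂ} (hk : k ≠ 0) (t : ℝ) : sinDiv k t = Complex.sin (k * t) / k := by
  rw [sinDiv, dslope_of_ne _ hk, slope_def_field]; simp

@[simp] lemma sinDiv_zero_right (k : ℂ) : sinDiv k 0 = 0 := by
  rcases eq_or_ne k 0 with rfl | hk
  · simp
  · simp [sinDiv_of_ne hk]

lemma mul_sinDiv (k : ℂ) (t : ℝ) : k * sinDiv k t = Complex.sin (k * t) := by
  rcases eq_or_ne k 0 with rfl | hk
  · simp
  · rw [sinDiv_of_ne hk, mul_div_cancel₀ _ hk]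

lemma differentiable_sinDiv (t : ℝ) : Differentiable ℂ (fun k => sinDiv k t) := by
  have h : DifferentiableOn ℂ (fun z => Complex.sin (z * t)) univ := fun z _ =>
    (hasDerivAt_sin_mul t z).differentiableAt.differentiableWithinAt
  exact differentiableOn_univ.1 ((Complex.differentiableOn_dslope Filter.univ_mem).2 h)

lemma hasDerivAt_ofReal_mul (k : ℂ) (t : ℝ) : HasDerivAt (fun t : ℝ => k * (t : ℂ)) k t := by
  simpa using (Complex.ofRealCLM.hasDerivAt (x := t)).const_mul k

lemma hasDerivAt_sinDiv (k : ℂ) (t : ℝ) :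
    HasDerivAt (fun t => sinDiv k t) (Complex.cos (k * t)) t := by
  rcases eq_or_ne k 0 with rfl | hk
  · simp only [sinDiv_zero_left, zero_mul, Complex.cos_zero]
    exact Complex.ofRealCLM.hasDerivAt (x := t)
  · simp only [sinDiv_of_ne hk]
    have := ((Complex.hasDerivAt_sin (k * t)).comp t (hasDerivAt_ofReal_mul k t)).div_const k
    exact this.congr_deriv (mul_div_cancel_right₀ _ hk)

lemma hasDerivAt_cos_mul (k : ℂ) (t : ℝ) :
    HasDerivAt (fun t : ℝ => Complex.cos (k * t)) (-(k ^ 2 * sinDiv k t)) t := by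
  have := (Complex.hasDerivAt_cos (k * t)).comp t (hasDerivAt_ofReal_mul k t)
  exact this.congr_deriv (by rw [← mul_sinDiv]; ring)

variable {p q : ℝ}

lemma hasDerivAt_sinDiv_sub_left (k : ℂ) (q t : ℝ) :
    HasDerivAt (fun t => sinDiv k (q - t)) (-Complex.cos (k * (q - t : ℝ))) t := by
  simpa [Function.comp_def] using
    (hasDerivAt_sinDiv k (q - t)).scomp t ((hasDerivAt_id t).const_sub q)

lemma hasDerivAt_cos_sub_left (k : ℂ) (q t : ℝ) :
    HasDerivAt (fun t : ℝ => Complex.cos (k * (q - t : ℝ))) (k ^ 2 * sinDiv k (q - t)) t := by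
  simpa [Function.comp_def] using
    (hasDerivAt_cos_mul k (q - t)).scomp t ((hasDerivAt_id t).const_sub q)

lemma hasDerivAt_sinDiv_sub_right (k : ℂ) (p t : ℝ) :
    HasDerivAt (fun t => sinDiv k (t - p)) (Complex.cos (k * (t - p : ℝ))) t := by
  simpa [Function.comp_def] using
    (hasDerivAt_sinDiv k (t - p)).scomp t ((hasDerivAt_id t).sub_const p)

lemma hasDerivAt_cos_sub_right (k : ℂ) (p t : ℝ) :
    HasDerivAt (fun t : ℝ => Complex.cos (k * (t - p : ℝ))) (-(k ^ 2 * sinDiv k (t - p))) t := by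
  simpa [Function.comp_def] using
    (hasDerivAt_cos_mul k (t - p)).scomp t ((hasDerivAt_id t).sub_const p)

/-- The outward derivative at an endpoint of a gap of length `s` of the solution of
`w'' + k² w = 0` with the value `a` at this endpoint and `b` at the other one. -/
noncomputable def gapDtN (k : ℂ) (s : ℝ) (a b : ℂ) : ℂ :=
  (b - Complex.cos (k * s) * a) / sinDiv k s

/-- The Wronskian of a solution with `sin (k (q - x)) / k` is constant. -/
lemma deriv_left_eq_gapDtN {k : ℂ} (hpq : p ≤ q) (hs : sinDiv k (q - p) ≠ 0) {w w' : ℝ → ℂ}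
    (hw : ∀ x ∈ Icc p q, HasDerivWithinAt w (w' x) (Icc p q) x)
    (hw' : ∀ x ∈ Icc p q, HasDerivWithinAt w' (-(k ^ 2 * w x)) (Icc p q) x) :
    w' p = gapDtN k (q - p) (w p) (w q) := by
  have h0 : ∀ x ∈ Icc p q, HasDerivWithinAt
      (fun x => w' x * sinDiv k (q - x) + w x * Complex.cos (k * (q - x : ℝ))) 0 (Icc p q) x := by
    intro x hx
    have := ((hw' x hx).mul (hasDerivAt_sinDiv_sub_left k q x).hasDerivWithinAt).add
      ((hw x hx).mul (hasDerivAt_cos_sub_left k q x).hasDerivWithinAt)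
    exact this.congr_deriv (by ring)
  have := (convex_Icc p q).eq_of_hasDerivWithinAt_zero h0 (left_mem_Icc.2 hpq) (right_mem_Icc.2 hpq)
  simp only [sub_self, sinDiv_zero_right, Complex.ofReal_zero, mul_zero, Complex.cos_zero] at this
  rw [gapDtN, eq_div_iff hs]
  linear_combination this

lemma neg_deriv_right_eq_gapDtN {k : ℂ} (hpq : p ≤ q) (hs : sinDiv k (q - p) ≠ 0)
    {w w' : ℝ → ℂ} (hw : ∀ x ∈ Icc p q, HasDerivWithinAt w (w' x) (Icc p q) x)
    (hw' : ∀ x ∈ Icc p q, HasDerivWithinAt w' (-(k ^ 2 * w x)) (Icc p q) x) :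
    -w' q = gapDtN k (q - p) (w q) (w p) := by
  have h0 : ∀ x ∈ Icc p q, HasDerivWithinAt
      (fun x => w' x * sinDiv k (x - p) - w x * Complex.cos (k * (x - p : ℝ))) 0 (Icc p q) x := by
    intro x hx
    have := ((hw' x hx).mul (hasDerivAt_sinDiv_sub_right k p x).hasDerivWithinAt).sub
      ((hw x hx).mul (hasDerivAt_cos_sub_right k p x).hasDerivWithinAt)
    exact this.congr_deriv (by ring)
  have := (convex_Icc p q).eq_of_hasDerivWithinAt_zero h0 (left_mem_Icc.2 hpq) (right_mem_Icc.2 hpq)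
  simp only [sub_self, sinDiv_zero_right, Complex.ofReal_zero, mul_zero, Complex.cos_zero] at this
  rw [gapDtN, eq_div_iff hs]
  linear_combination this

end sinDiv

namespace ResonatorChain

section geometry
variable {N : ℕ} (c : ResonatorChain N)

lemma strictMono_xL : StrictMono c.xL := fun i j h =>
  (c.left_lt_right i).trans (c.right_lt_left i j h)

lemma strictMono_xR : StrictMono c.xR := fun i j h =>
  (c.right_lt_left i j h).trans (c.left_lt_right j)

lemma mem_exterior {x : ℝ} : x ∈ c.exterior ↔ ∀ i, c.xL i < x → c.xR i ≤ x := by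
  simp [exterior, D]

lemma xL_mem_exterior (i : Fin N) : c.xL i ∈ c.exterior := c.xL_notMem_D i

lemma xR_mem_exterior (i : Fin N) : c.xR i ∈ c.exterior := c.xR_notMem_D i

end geometry

variable {n : ℕ} (c : ResonatorChain (n + 1))

/-- The gaps between consecutive resonators, themselves a chain of intervals. -/
def gaps : ResonatorChain n where
  xL i := c.xR i.castSucc
  xR i := c.xL i.succ
  left_lt_right i := c.right_lt_left _ _ i.castSucc_lt_succ
  right_lt_left _ _ h := (c.left_lt_right _).trans_le
    (c.strictMono_xR.monotone (Fin.succ_le_castSucc_iff.2 h))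

lemma isCell_gap (i : Fin n) : IsCell c.exterior (Icc (c.gaps.xL i) (c.gaps.xR i)) where
  eventuallyEq x hx := by
    refine Filter.eventuallyEq_set.2 ?_
    have h1 : c.xL i.castSucc < x := (c.left_lt_right _).trans_le hx.1
    have h2 : x < c.xR i.succ := hx.2.trans_lt (c.left_lt_right _)
    filter_upwards [Ioo_mem_nhds h1 h2] with y hy
    refine ⟨fun h => ?_, fun h => ?_⟩
    · rw [mem_exterior] at h
      refine ⟨h _ hy.1, ?_⟩
      by_contra hlt
      exact (h i.succ (not_le.1 hlt)).not_gt hy.2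
    · rw [mem_exterior]
      intro j hj
      by_cases hji : j ≤ i.castSucc
      · exact (c.strictMono_xR.monotone hji).trans h.1
      · have : i.succ ≤ j := by
          rw [not_le, Fin.castSucc_lt_iff_succ_le] at hji; exact hji
        exact absurd (h.2.trans (c.strictMono_xL.monotone this)) (not_le.2 hj)
  uniqueDiffOn := uniqueDiffOn_Icc (c.gaps.left_lt_right i)

lemma isCell_Iic : IsCell c.exterior (Iic (c.xL 0)) where
  eventuallyEq x hx := by
    refine Filter.eventuallyEq_set.2 ?_
    have h2 : x < c.xR 0 := lt_of_le_of_lt hx (c.left_lt_right _)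
    filter_upwards [Iio_mem_nhds h2] with y hy
    refine ⟨fun h => ?_, fun h => ?_⟩
    · rw [mem_exterior] at h
      by_contra hlt
      exact (h 0 (not_le.1 hlt)).not_gt hy
    · rw [mem_exterior]
      intro j hj
      exact absurd (le_trans h (c.strictMono_xL.monotone (Fin.zero_le j))) (not_le.2 hj)
  uniqueDiffOn := uniqueDiffOn_Iic _

lemma isCell_Ici : IsCell c.exterior (Ici (c.xR (Fin.last n))) where
  eventuallyEq x hx := by
    refine Filter.eventuallyEq_set.2 ?_
    have h2 : c.xL (Fin.last n) < x := lt_of_lt_of_le (c.left_lt_right _) hx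
    filter_upwards [Ioi_mem_nhds h2] with y hy
    refine ⟨fun h => ?_, fun h => ?_⟩
    · rw [mem_exterior] at h
      exact h _ hy
    · rw [mem_exterior]
      intro j _
      exact (c.strictMono_xR.monotone (Fin.le_last j)).trans h
  uniqueDiffOn := uniqueDiffOn_Ici _

lemma exterior_cases {x : ℝ} (hx : x ∈ c.exterior) :
    x ≤ c.xL 0 ∨ c.xR (Fin.last n) ≤ x ∨ ∃ i, x ∈ Icc (c.gaps.xL i) (c.gaps.xR i) := by
  rw [mem_exterior] at hx
  refine or_iff_not_imp_left.2 fun h0 => ?_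
  rw [not_le] at h0
  obtain ⟨j, hj, hmax⟩ := (Finset.univ.filter fun j => c.xL j < x).exists_max_image id
    ⟨0, by simpa using h0⟩
  simp only [Finset.mem_filter, Finset.mem_univ, true_and, id] at hj hmax
  induction j using Fin.lastCases with
  | last => exact .inl (hx _ hj)
  | cast i =>
    refine .inr ⟨i, hx _ hj, ?_⟩
    by_contra h
    exact (hmax i.succ (not_le.1 h)).not_gt i.castSucc_lt_succ

/-- The Dirichlet-to-Neumann map in closed form: `i k` times the boundary value at the two outermost
endpoints, `gapDtN` at the endpoints of the gaps. -/
noncomputable def dtnMap (k : ℂ) :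
    (Fin (n + 1) ⊕ Fin (n + 1) → ℂ) →ₗ[ℂ] (Fin (n + 1) ⊕ Fin (n + 1) → ℂ) where
  toFun f := Sum.elim
    (Fin.cases (Complex.I * k * f (.inl 0)) fun i =>
      gapDtN k (c.gaps.len i) (f (.inl i.succ)) (f (.inr i.castSucc)))
    (Fin.lastCases (Complex.I * k * f (.inr (Fin.last n))) fun i =>
      gapDtN k (c.gaps.len i) (f (.inr i.castSucc)) (f (.inl i.succ)))
  map_add' f g := by
    ext (i | i)
    · cases i using Fin.cases <;> simp [gapDtN] <;> ring
    · cases i using Fin.lastCases <;> simp [gapDtN] <;> ring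
  map_smul' a f := by
    ext (i | i)
    · cases i using Fin.cases <;> simp [gapDtN] <;> ring
    · cases i using Fin.lastCases <;> simp [gapDtN] <;> ring

section dtnMap
variable (k : ℂ) (f : Fin (n + 1) ⊕ Fin (n + 1) → ℂ)

@[simp] lemma dtnMap_inl_zero : c.dtnMap k f (.inl 0) = Complex.I * k * f (.inl 0) := rfl

@[simp] lemma dtnMap_inl_succ (i : Fin n) : c.dtnMap k f (.inl i.succ) =
    gapDtN k (c.gaps.len i) (f (.inl i.succ)) (f (.inr i.castSucc)) := rfl

@[simp] lemma dtnMap_inr_last : c.dtnMap k f (.inr (Fin.last n)) =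
    Complex.I * k * f (.inr (Fin.last n)) := by simp [dtnMap]

@[simp] lemma dtnMap_inr_castSucc (i : Fin n) : c.dtnMap k f (.inr i.castSucc) =
    gapDtN k (c.gaps.len i) (f (.inr i.castSucc)) (f (.inl i.succ)) := by simp [dtnMap]

end dtnMap

/-- The outer problem with wave number `k` is uniquely solvable: `k` is none of the numbers `n π / sᵢ`
with `n ≠ 0`, which are the zeros of `k ↦ sinDiv k sᵢ`. -/
def Nonresonant (k : ℂ) : Prop := ∀ i, sinDiv k (c.gaps.len i) ≠ 0

lemma nonresonant_zero : c.Nonresonant 0 := fun i => by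
  rw [sinDiv_zero_left]
  exact Complex.ofReal_ne_zero.2 (sub_ne_zero.2 (c.gaps.left_lt_right i).ne')

variable {c}
section uniqueness
variable {k : ℂ} {f : Fin (n + 1) ⊕ Fin (n + 1) → ℂ} {w : ℝ → ℂ}

lemma IsOuterSolution.hasDerivWithinAt_deriv (hw : c.IsOuterSolution k f w) {S : Set ℝ}
    (hS : IsCell c.exterior S) {x : ℝ} (hx : x ∈ S) :
    HasDerivWithinAt (derivWithin w c.exterior) (-(k ^ 2 * w x)) S x := by
  have h := hS.hasDerivWithinAt hw.differentiable' hx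
  rwa [eq_neg_of_add_eq_zero_left (hw.helmholtz x (hS.subset hx))] at h

/-- The radiation condition, extended by continuity to the endpoint of the unbounded component. -/
lemma IsOuterSolution.neg_deriv_xL_zero (hw : c.IsOuterSolution k f w) {x : ℝ} (hx : x ≤ c.xL 0) :
    -derivWithin w c.exterior x = Complex.I * k * w x := by
  have hlt : ∀ y < c.xL 0, -derivWithin w c.exterior y - Complex.I * k * w y = 0 := fun y hy =>
    hw.radiation_left y fun i => hy.trans_le (c.strictMono_xL.monotone (Fin.zero_le i))
  rcases hx.lt_or_eq with h | rfl
  · exact sub_eq_zero.1 (hlt x h)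
  have h1 := (hw.hasDerivWithinAt_deriv c.isCell_Iic self_mem_Iic).continuousWithinAt
  have h2 := (c.isCell_Iic.hasDerivWithinAt hw.differentiable self_mem_Iic).continuousWithinAt
  have h3 := (h1.neg.sub (h2.const_mul (Complex.I * k))).mono Iio_subset_Iic_self
  have h4 : Filter.Tendsto (fun y => -derivWithin w c.exterior y - Complex.I * k * w y)
      (𝓝[<] (c.xL 0)) (𝓝 0) :=
    tendsto_const_nhds.congr' (by
      filter_upwards [self_mem_nhdsWithin] with y hy using (hlt y hy).symm)
  exact sub_eq_zero.1 (tendsto_nhds_unique h3 h4)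

lemma IsOuterSolution.deriv_xR_last (hw : c.IsOuterSolution k f w) {x : ℝ}
    (hx : c.xR (Fin.last n) ≤ x) : derivWithin w c.exterior x = Complex.I * k * w x := by
  have hlt : ∀ y, c.xR (Fin.last n) < y → derivWithin w c.exterior y - Complex.I * k * w y = 0 :=
    fun y hy => hw.radiation_right y fun i =>
      (c.strictMono_xR.monotone (Fin.le_last i)).trans_lt hy
  rcases hx.lt_or_eq with h | rfl
  · exact sub_eq_zero.1 (hlt x h)
  have h1 := (hw.hasDerivWithinAt_deriv c.isCell_Ici self_mem_Ici).continuousWithinAt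
  have h2 := (c.isCell_Ici.hasDerivWithinAt hw.differentiable self_mem_Ici).continuousWithinAt
  have h3 := (h1.sub (h2.const_mul (Complex.I * k))).mono Ioi_subset_Ici_self
  have h4 : Filter.Tendsto (fun y => derivWithin w c.exterior y - Complex.I * k * w y)
      (𝓝[>] (c.xR (Fin.last n))) (𝓝 0) :=
    tendsto_const_nhds.congr' (by
      filter_upwards [self_mem_nhdsWithin] with y hy using (hlt y hy).symm)
  exact sub_eq_zero.1 (tendsto_nhds_unique h3 h4)

lemma IsOuterSolution.neg_deriv_xL (hk : c.Nonresonant k) (hw : c.IsOuterSolution k f w)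
    (i : Fin (n + 1)) : -derivWithin w c.exterior (c.xL i) = c.dtnMap k f (.inl i) := by
  cases i using Fin.cases with
  | zero => rw [hw.neg_deriv_xL_zero le_rfl, hw.left, dtnMap_inl_zero]
  | succ i =>
    have h := neg_deriv_right_eq_gapDtN (c.gaps.left_le_right i) (hk i)
      (fun x hx => (c.isCell_gap i).hasDerivWithinAt hw.differentiable hx)
      (fun x hx => hw.hasDerivWithinAt_deriv (c.isCell_gap i) hx)
    rw [dtnMap_inl_succ, ← hw.left, ← hw.right]
    exact h

lemma IsOuterSolution.deriv_xR (hk : c.Nonresonant k) (hw : c.IsOuterSolution k f w)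
    (i : Fin (n + 1)) : derivWithin w c.exterior (c.xR i) = c.dtnMap k f (.inr i) := by
  cases i using Fin.lastCases with
  | last => rw [hw.deriv_xR_last le_rfl, hw.right, dtnMap_inr_last]
  | cast i =>
    have h := deriv_left_eq_gapDtN (c.gaps.left_le_right i) (hk i)
      (fun x hx => (c.isCell_gap i).hasDerivWithinAt hw.differentiable hx)
      (fun x hx => hw.hasDerivWithinAt_deriv (c.isCell_gap i) hx)
    rw [dtnMap_inr_castSucc, ← hw.left, ← hw.right]
    exact h

end uniqueness

section existence
variable {k : ℂ} {f : Fin (n + 1) ⊕ Fin (n + 1) → ℂ}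

/-- The derivatives of a function that agrees on a cell of the exterior with a solution `φ` of the
Helmholtz equation. -/
lemma helmholtz_of_eqOn {S : Set ℝ} (hS : IsCell c.exterior S) {w φ φ' : ℝ → ℂ}
    (hw : EqOn w φ S) (h1 : ∀ x, HasDerivAt φ (φ' x) x)
    (h2 : ∀ x, HasDerivAt φ' (-(k ^ 2 * φ x)) x) {x : ℝ} (hx : x ∈ S) :
    DifferentiableWithinAt ℝ w c.exterior x ∧
    DifferentiableWithinAt ℝ (derivWithin w c.exterior) c.exterior x ∧
    derivWithin (derivWithin w c.exterior) c.exterior x + k ^ 2 * w x = 0 := by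
  have e := hS.derivWithin_eqOn hw h1
  refine ⟨(hS.hasDerivWithinAt_of_eqOn hw h1 hx).differentiableWithinAt,
    (hS.hasDerivWithinAt_of_eqOn e h2 hx).differentiableWithinAt, ?_⟩
  rw [hS.derivWithin_eqOn e h2 hx, hw hx, neg_add_cancel]

lemma exists_isOuterSolution (hk : c.Nonresonant k) (f : Fin (n + 1) ⊕ Fin (n + 1) → ℂ) :
    ∃ w, c.IsOuterSolution k f w := by
  -- outgoing exponentials on the unbounded components, combinations of sines on the gaps
  let E (a : ℂ) (x : ℝ) : ℂ := Complex.exp (a * x)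
  have hE (a b : ℂ) (x₀ x : ℝ) : HasDerivAt (fun x => b * E a (x - x₀))
      (b * a * E a (x - x₀)) x := by
    have := ((hasDerivAt_ofReal_mul a (x - x₀)).cexp.scomp x
      ((hasDerivAt_id x).sub_const x₀)).const_mul b
    simpa [E, Function.comp_def, mul_assoc, mul_comm, mul_left_comm] using this
  let φL (x : ℝ) : ℂ := f (.inl 0) * E (-(Complex.I * k)) (x - c.xL 0)
  let φR (x : ℝ) : ℂ := f (.inr (Fin.last n)) * E (Complex.I * k) (x - c.xR (Fin.last n))
  let φ (i : Fin n) (x : ℝ) : ℂ := (f (.inr i.castSucc) * sinDiv k (c.gaps.xR i - x)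
    + f (.inl i.succ) * sinDiv k (x - c.gaps.xL i)) / sinDiv k (c.gaps.len i)
  let φ' (i : Fin n) (x : ℝ) : ℂ :=
    (f (.inr i.castSucc) * -Complex.cos (k * (c.gaps.xR i - x : ℝ))
      + f (.inl i.succ) * Complex.cos (k * (x - c.gaps.xL i : ℝ))) / sinDiv k (c.gaps.len i)
  let w (x : ℝ) : ℂ := if x ≤ c.xL 0 then φL x else if c.xR (Fin.last n) ≤ x then φR x else
    ∑ i, (Icc (c.gaps.xL i) (c.gaps.xR i)).indicator (φ i) x
  have hlt : c.xL 0 < c.xR (Fin.last n) :=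
    (c.strictMono_xL.monotone (Fin.zero_le _)).trans_lt (c.left_lt_right _)
  have wL : EqOn w φL (Iic (c.xL 0)) := fun x hx => if_pos hx
  have wR : EqOn w φR (Ici (c.xR (Fin.last n))) := fun x hx => by
    simp only [w]
    rw [if_neg (not_le.2 (hlt.trans_le hx)), if_pos (mem_Ici.1 hx)]
  have wG (i : Fin n) : EqOn w (φ i) (Icc (c.gaps.xL i) (c.gaps.xR i)) := fun x hx => by
    have h1 : c.xL 0 < x := (c.strictMono_xL.monotone (Fin.zero_le i.castSucc)).trans_lt
      ((c.left_lt_right _).trans_le hx.1)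
    have h2 : x < c.xR (Fin.last n) := (hx.2.trans_lt (c.left_lt_right _)).trans_le
      (c.strictMono_xR.monotone (Fin.le_last i.succ))
    simp only [w]
    rw [if_neg (not_le.2 h1), if_neg (not_le.2 h2)]
    exact c.gaps.sum_indicator_eq φ hx
  have dL := hE (-(Complex.I * k)) (f (.inl 0)) (c.xL 0)
  have dR := hE (Complex.I * k) (f (.inr (Fin.last n))) (c.xR (Fin.last n))
  have hG {x : ℝ} (i : Fin n) (hx : x ∈ Icc (c.gaps.xL i) (c.gaps.xR i)) :=
    helmholtz_of_eqOn (k := k) (φ' := φ' i) (c.isCell_gap i) (wG i)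
      (fun x => (((hasDerivAt_sinDiv_sub_left k (c.gaps.xR i) x).const_mul _).add
        ((hasDerivAt_sinDiv_sub_right k (c.gaps.xL i) x).const_mul _)).div_const _)
      (fun x => by
        refine HasDerivAt.congr_deriv ((((hasDerivAt_cos_sub_left k (c.gaps.xR i) x).neg.const_mul
          (f (.inr i.castSucc))).add ((hasDerivAt_cos_sub_right k (c.gaps.xL i) x).const_mul
          (f (.inl i.succ)))).div_const (sinDiv k (c.gaps.len i))) ?_
        simp only [φ]; ring) hx
  have hL {x : ℝ} (hx : x ∈ Iic (c.xL 0)) :=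
    helmholtz_of_eqOn (k := k) c.isCell_Iic wL dL (fun x => by
      convert hE (-(Complex.I * k)) (f (.inl 0) * -(Complex.I * k)) (c.xL 0) x using 1
      simp only [φL]; linear_combination (-(k ^ 2 * f (.inl 0) *
        E (-(Complex.I * k)) (x - c.xL 0))) * Complex.I_sq) hx
  have hR {x : ℝ} (hx : x ∈ Ici (c.xR (Fin.last n))) :=
    helmholtz_of_eqOn (k := k) c.isCell_Ici wR dR (fun x => by
      convert hE (Complex.I * k) (f (.inr (Fin.last n)) * (Complex.I * k)) (c.xR (Fin.last n)) x
        using 1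
      simp only [φR]; linear_combination (-(k ^ 2 * f (.inr (Fin.last n)) *
        E (Complex.I * k) (x - c.xR (Fin.last n)))) * Complex.I_sq) hx
  have hall : ∀ x ∈ c.exterior, DifferentiableWithinAt ℝ w c.exterior x ∧
      DifferentiableWithinAt ℝ (derivWithin w c.exterior) c.exterior x ∧
      derivWithin (derivWithin w c.exterior) c.exterior x + k ^ 2 * w x = 0 := by
    intro x hx
    rcases c.exterior_cases hx with h | h | ⟨i, h⟩
    exacts [hL h, hR h, hG i h]
  refine ⟨w, ⟨fun x hx => (hall x hx).1, fun x hx => (hall x hx).2.1,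
    fun x hx => (hall x hx).2.2, fun i => ?_, fun i => ?_, fun x hx => ?_, fun x hx => ?_⟩⟩
  · cases i using Fin.cases with
    | zero => rw [wL self_mem_Iic]; simp [φL, E]
    | succ i =>
      have hi := hk i
      rw [wG i (right_mem_Icc.2 (c.gaps.left_le_right i)) (x := c.xL i.succ)]
      simp only [φ]
      rw [show c.xL i.succ = c.gaps.xR i from rfl, ← len, sub_self, sinDiv_zero_right]
      field_simp; ring
  · cases i using Fin.lastCases with
    | last => rw [wR self_mem_Ici]; simp [φR, E]
    | cast i =>
      have hi := hk i
      rw [wG i (left_mem_Icc.2 (c.gaps.left_le_right i)) (x := c.xR i.castSucc)]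
      simp only [φ]
      rw [show c.xR i.castSucc = c.gaps.xL i from rfl, ← len, sub_self, sinDiv_zero_right]
      field_simp; ring
  · have hx' : x ∈ Iic (c.xL 0) := (hx 0).le
    rw [c.isCell_Iic.derivWithin_eqOn wL dL hx', wL hx']
    simp only [φL]; ring
  · have hx' : x ∈ Ici (c.xR (Fin.last n)) := (hx _).le
    rw [c.isCell_Ici.derivWithin_eqOn wR dR hx', wR hx']
    simp only [φR]; ring

/-- Existence and uniqueness for the outer problem identify the Dirichlet-to-Neumann map. -/
lemma dtn_eq_dtnMap (hk : c.Nonresonant k) (f : Fin (n + 1) ⊕ Fin (n + 1) → ℂ) :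
    c.dtn k f = c.dtnMap k f := by
  have hw := Classical.epsilon_spec (exists_isOuterSolution hk f)
  ext (i | i)
  · exact hw.neg_deriv_xL hk i
  · exact hw.deriv_xR hk i

end existence
end ResonatorChain

/-! ### The Dirichlet-to-Neumann map near `k = 0` and the potentials -/

namespace ResonatorChain
variable {n : ℕ} (c : ResonatorChain (n + 1))

section bounds

lemma differentiableAt_gapDtN {s : ℝ} (hs : s ≠ 0) (a b : ℂ) :
    DifferentiableAt ℂ (fun k => gapDtN k s a b) 0 := by
  unfold gapDtN
  refine DifferentiableAt.div (by fun_prop) (differentiable_sinDiv s 0) ?_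
  rw [sinDiv_zero_left]
  exact Complex.ofReal_ne_zero.2 hs

lemma len_pos {N : ℕ} (c : ResonatorChain N) (i : Fin N) : 0 < c.len i :=
  sub_pos.2 (c.left_lt_right i)

lemma differentiableAt_dtnMap (f : Fin (n + 1) ⊕ Fin (n + 1) → ℂ) (e : Fin (n + 1) ⊕ Fin (n + 1)) :
    DifferentiableAt ℂ (fun k => c.dtnMap k f e) 0 := by
  rcases e with i | i
  · cases i using Fin.cases with
    | zero => simp only [dtnMap_inl_zero]; fun_prop
    | succ i => exact differentiableAt_gapDtN (c.gaps.len_pos i).ne' _ _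
  · cases i using Fin.lastCases with
    | last => simp only [dtnMap_inr_last]; fun_prop
    | cast i =>
      simp only [dtnMap_inr_castSucc]
      exact differentiableAt_gapDtN (c.gaps.len_pos i).ne' _ _

lemma eventually_nonresonant : ∀ᶠ k in 𝓝 0, c.Nonresonant k :=
  Filter.eventually_all.2 fun i =>
    (differentiable_sinDiv (c.gaps.len i)).continuous.continuousAt.eventually_ne
      (c.nonresonant_zero i)

lemma exists_dtnMap_sub_le : ∃ C, 0 ≤ C ∧ ∀ᶠ k in 𝓝 0, ∀ f e,
    ‖c.dtnMap k f e - c.dtnMap 0 f e‖ ≤ C * ‖k‖ * ‖f‖ := by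
  have h1 (f : Fin (n + 1) ⊕ Fin (n + 1) → ℂ) (e : Fin (n + 1) ⊕ Fin (n + 1)) :
      ∃ C, 0 ≤ C ∧ ∀ᶠ k in 𝓝 0, ‖c.dtnMap k f e - c.dtnMap 0 f e‖ ≤ C * ‖k‖ := by
    obtain ⟨C, hC, h⟩ := (c.differentiableAt_dtnMap f e).isBigO_sub.exists_nonneg
    refine ⟨C, hC, h.bound.mono fun k hk => by simpa using hk⟩
  choose C hC hb using h1
  -- by linearity it suffices to treat the standard basis
  let b (j : Fin (n + 1) ⊕ Fin (n + 1)) : Fin (n + 1) ⊕ Fin (n + 1) → ℂ :=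
    fun l => if j = l then 1 else 0
  refine ⟨∑ e, ∑ j, C (b j) e, Finset.sum_nonneg fun e _ => Finset.sum_nonneg fun j _ => hC _ _, ?_⟩
  filter_upwards [Filter.eventually_all.2 fun e => Filter.eventually_all.2 fun j => hb (b j) e]
    with k hk f e
  have hsum (z : ℂ) : c.dtnMap z f e = ∑ j, f j * c.dtnMap z (b j) e := by
    rw [LinearMap.pi_apply_eq_sum_univ (c.dtnMap z) f]
    simp [b, Finset.sum_apply]
  rw [hsum, hsum, ← Finset.sum_sub_distrib]
  calc ‖∑ j, (f j * c.dtnMap k (b j) e - f j * c.dtnMap 0 (b j) e)‖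
      ≤ ∑ j, ‖f j * c.dtnMap k (b j) e - f j * c.dtnMap 0 (b j) e‖ := norm_sum_le _ _
    _ ≤ ∑ j, C (b j) e * ‖k‖ * ‖f‖ := by
        refine Finset.sum_le_sum fun j _ => ?_
        rw [← mul_sub, norm_mul, mul_comm]
        exact mul_le_mul (hk e j) (norm_le_pi_norm f j) (norm_nonneg _)
          (mul_nonneg (hC _ _) (norm_nonneg _))
    _ = (∑ j, C (b j) e) * ‖k‖ * ‖f‖ := by rw [Finset.sum_mul, Finset.sum_mul]
    _ ≤ (∑ e, ∑ j, C (b j) e) * ‖k‖ * ‖f‖ := by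
        refine mul_le_mul_of_nonneg_right (mul_le_mul_of_nonneg_right ?_ (norm_nonneg _))
          (norm_nonneg _)
        exact Finset.single_le_sum (f := fun e => ∑ j, C (b j) e) (s := Finset.univ)
          (fun e _ => Finset.sum_nonneg fun j _ => hC _ _) (Finset.mem_univ e)

/-- Near `k = 0` the Dirichlet-to-Neumann map is linear, bounded uniformly in `k`, and
Lipschitz continuous at `k = 0`. -/
lemma exists_dtn_bounds : ∃ C, 0 ≤ C ∧ ∀ᶠ k in 𝓝 0, ∀ f,
    c.dtn k f = c.dtnMap k f ∧
    (∀ e, ‖c.dtnMap k f e‖ ≤ C * ‖f‖) ∧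
    ∀ e, ‖c.dtnMap k f e - c.dtnMap 0 f e‖ ≤ C * ‖k‖ * ‖f‖ := by
  obtain ⟨C, hC, hb⟩ := c.exists_dtnMap_sub_le
  let T := LinearMap.toContinuousLinearMap (c.dtnMap 0)
  have hT (f) (e) : ‖c.dtnMap 0 f e‖ ≤ ‖T‖ * ‖f‖ :=
    (norm_le_pi_norm (c.dtnMap 0 f) e).trans (T.le_opNorm f)
  refine ⟨C + ‖T‖, by positivity, ?_⟩
  filter_upwards [hb, c.eventually_nonresonant, Metric.ball_mem_nhds (0 : ℂ) one_pos]
    with k hk hk' hk1 f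
  rw [mem_ball_zero_iff] at hk1
  refine ⟨dtn_eq_dtnMap hk' f, fun e => ?_, fun e => (hk f e).trans ?_⟩
  · calc ‖c.dtnMap k f e‖ ≤ ‖c.dtnMap k f e - c.dtnMap 0 f e‖ + ‖c.dtnMap 0 f e‖ := by
          simpa using norm_add_le (c.dtnMap k f e - c.dtnMap 0 f e) (c.dtnMap 0 f e)
      _ ≤ C * ‖k‖ * ‖f‖ + ‖T‖ * ‖f‖ := add_le_add (hk f e) (hT f e)
      _ ≤ C * 1 * ‖f‖ + ‖T‖ * ‖f‖ := by gcongr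
      _ = _ := by ring
  · gcongr
    exact le_add_of_nonneg_right (norm_nonneg _)

end bounds

section potential

/-- The traces of the indicator function of the `j`-th resonator. -/
def indicatorTrace {N : ℕ} (j : Fin N) : Fin N ⊕ Fin N → ℂ :=
  Sum.elim (Pi.single j 1) (Pi.single j 1)

lemma uniqueDiffOn_exterior : UniqueDiffOn ℝ c.exterior := fun x hx => by
  rcases c.exterior_cases hx with h | h | ⟨i, h⟩
  exacts [c.isCell_Iic.uniqueDiffWithinAt h, c.isCell_Ici.uniqueDiffWithinAt h,
    (c.isCell_gap i).uniqueDiffWithinAt h]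

variable {c}

open Filter in
/-- A bounded affine function on an unbounded component is constant. Hence boundedness of a potential
plays the role of the radiation condition for `k = 0`. -/
lemma derivWithin_eq_zero_of_isBigO_one {S : Set ℝ} (hS : IsCell c.exterior S) (hconv : Convex ℝ S)
    {l : Filter ℝ} [l.NeBot] (hl : l ≤ Bornology.cobounded ℝ) (hSl : S ∈ l) {V : ℝ → ℝ}
    (hd : DifferentiableOn ℝ V c.exterior)
    (hd' : DifferentiableOn ℝ (derivWithin V c.exterior) c.exterior)
    (h0 : ∀ x ∈ c.exterior, derivWithin (derivWithin V c.exterior) c.exterior x = 0)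
    (hb : V =O[Bornology.cobounded ℝ] (fun _ => (1 : ℝ))) {x : ℝ} (hx : x ∈ S) :
    derivWithin V c.exterior x = 0 := by
  set m := derivWithin V c.exterior x with hm
  have hconst : ∀ y ∈ S, derivWithin V c.exterior y = m := fun y hy =>
    hconv.eq_of_hasDerivWithinAt_zero (fun z hz => by
      have := hS.hasDerivWithinAt hd' hz
      rwa [h0 z (hS.subset hz)] at this) hy hx
  have haff : ∀ y ∈ S, V y - m * y = V x - m * x := fun y hy =>
    hconv.eq_of_hasDerivWithinAt_zero (f := fun y => V y - m * y) (fun z hz => by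
      have h1 := hS.hasDerivWithinAt hd hz
      rw [hconst z hz] at h1
      exact (h1.sub ((hasDerivAt_id z).const_mul m).hasDerivWithinAt).congr_deriv (by simp)) hy hx
  by_contra hne
  have h1 : (fun y : ℝ => m * y) =O[l] (fun _ => (1 : ℝ)) := by
    have h2 : (fun y : ℝ => V y - (V x - m * x)) =O[l] (fun _ => (1 : ℝ)) :=
      (hb.mono hl).sub (Asymptotics.isBigO_const_const _ one_ne_zero l)
    refine h2.congr' ?_ EventuallyEq.rfl
    filter_upwards [hSl] with y hy
    linarith [haff y hy]
  have h2 : (fun y : ℝ => y) =O[l] (fun _ => (1 : ℝ)) := by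
    simpa [hne] using h1.const_mul_left m⁻¹
  rw [Asymptotics.isBigO_one_iff] at h2
  exact not_isBoundedUnder_of_tendsto_atTop (tendsto_norm_cobounded_atTop.mono_left hl) h2

/-- A potential solves the outer problem for `k = 0`, with the traces of an indicator function as
boundary data. -/
lemma IsPotential.isOuterSolution {j : Fin (n + 1)} {V : ℝ → ℝ} (hV : c.IsPotential j V) :
    c.IsOuterSolution 0 (indicatorTrace j) (fun x => V x) ∧
      ∀ x ∈ c.exterior, derivWithin (fun x => (V x : ℂ)) c.exterior x
        = ((derivWithin V c.exterior x : ℝ) : ℂ) := by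
  have hu := c.uniqueDiffOn_exterior
  have hd : ∀ x ∈ c.exterior, HasDerivWithinAt (fun x => (V x : ℂ))
      ((derivWithin V c.exterior x : ℝ) : ℂ) c.exterior x := fun x hx =>
    (hV.differentiable x hx).hasDerivWithinAt.ofReal_comp
  have e : ∀ x ∈ c.exterior, derivWithin (fun x => (V x : ℂ)) c.exterior x
      = ((derivWithin V c.exterior x : ℝ) : ℂ) := fun x hx =>
    (hd x hx).derivWithin (hu x hx)
  have hd' : ∀ x ∈ c.exterior, HasDerivWithinAt (derivWithin (fun x => (V x : ℂ)) c.exterior)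
      0 c.exterior x := fun x hx => by
    have := (hV.differentiable' x hx).hasDerivWithinAt.ofReal_comp
    rw [hV.laplace x hx, Complex.ofReal_zero] at this
    exact this.congr e (e x hx)
  have hval : ∀ i, ∀ x ∈ Icc (c.xL i) (c.xR i), (V x : ℂ) = (Pi.single j 1 : Fin (n + 1) → ℂ) i := by
    intro i x hx
    by_cases hij : i = j
    · subst hij; rw [hV.eq_one x hx]; simp
    · rw [hV.eq_zero i hij x hx]; simp [hij]
  refine ⟨⟨fun x hx => (hd x hx).differentiableWithinAt,
    fun x hx => (hd' x hx).differentiableWithinAt, fun x hx => ?_,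
    fun i => hval i _ (left_mem_Icc.2 (c.left_le_right i)),
    fun i => hval i _ (right_mem_Icc.2 (c.left_le_right i)), fun x hx => ?_, fun x hx => ?_⟩, e⟩
  · rw [(hd' x hx).derivWithin (hu x hx)]; simp
  · have hx' : x ∈ Iic (c.xL 0) := (hx 0).le
    rw [e x (c.isCell_Iic.subset hx'), derivWithin_eq_zero_of_isBigO_one c.isCell_Iic (convex_Iic _)
      IsOrderBornology.atBot_le_cobounded (Filter.Iic_mem_atBot _) hV.differentiable hV.differentiable'
      hV.laplace hV.bounded hx']
    simp
  · have hx' : x ∈ Ici (c.xR (Fin.last n)) := (hx _).le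
    rw [e x (c.isCell_Ici.subset hx'), derivWithin_eq_zero_of_isBigO_one c.isCell_Ici (convex_Ici _)
      IsOrderBornology.atTop_le_cobounded (Filter.Ici_mem_atTop _) hV.differentiable hV.differentiable'
      hV.laplace hV.bounded hx']
    simp

lemma exists_isPotential (j : Fin (n + 1)) : ∃ V, c.IsPotential j V := by
  classical
  obtain ⟨w, hw⟩ := exists_isOuterSolution c.nonresonant_zero (indicatorTrace j)
  have hu := c.uniqueDiffOn_exterior
  -- the outer solution for `k = 0`, continued into the resonators by its boundary values
  let V (x : ℝ) : ℝ := if x ∈ c.exterior then (w x).re else if x ∈ Icc (c.xL j) (c.xR j) then 1 else 0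
  have hVe : ∀ x ∈ c.exterior, V x = (w x).re := fun x hx => if_pos hx
  have hd : ∀ x ∈ c.exterior, HasDerivWithinAt V (derivWithin w c.exterior x).re c.exterior x :=
    fun x hx => (Complex.reCLM.hasFDerivAt.comp_hasDerivWithinAt x
      (hw.differentiable x hx).hasDerivWithinAt).congr hVe (hVe x hx)
  have e : EqOn (derivWithin V c.exterior) (fun x => (derivWithin w c.exterior x).re) c.exterior :=
    fun x hx => (hd x hx).derivWithin (hu x hx)
  have hd' : ∀ x ∈ c.exterior, HasDerivWithinAt (derivWithin V c.exterior) 0 c.exterior x := by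
    intro x hx
    have h1 := (Complex.reCLM.hasFDerivAt.comp_hasDerivWithinAt x
      (hw.differentiable' x hx).hasDerivWithinAt).congr e (e hx)
    have h2 := hw.helmholtz x hx
    rw [zero_pow two_ne_zero, zero_mul, add_zero] at h2
    simpa [h2] using h1
  have hval : ∀ i, ∀ x ∈ Icc (c.xL i) (c.xR i), V x = (Pi.single j 1 : Fin (n + 1) → ℝ) i := by
    intro i x hx
    have hre : ((Pi.single j 1 : Fin (n + 1) → ℂ) i).re = (Pi.single j 1 : Fin (n + 1) → ℝ) i := by
      by_cases hij : i = j
      · subst hij; simp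
      · simp [hij]
    by_cases hxD : x ∈ Ioo (c.xL i) (c.xR i)
    · have : x ∉ c.exterior := fun h => h (c.Ioo_subset_D i hxD)
      simp only [V, if_neg this]
      by_cases hij : i = j
      · subst hij; simp only [if_pos hx, Pi.single_eq_same]
      · rw [if_neg (Set.disjoint_left.1 (c.disjoint_Icc hij) hx)]; simp [hij]
    · rcases eq_endpoints_or_mem_Ioo_of_mem_Icc hx with rfl | rfl | h
      · rw [hVe _ (c.xL_mem_exterior i), hw.left, ← hre]; rfl
      · rw [hVe _ (c.xR_mem_exterior i), hw.right, ← hre]; rfl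
      · exact absurd h hxD
  have hL : ∀ x ∈ Iic (c.xL 0), w x = w (c.xL 0) := fun x hx =>
    (convex_Iic (c.xL 0)).eq_of_hasDerivWithinAt_zero (fun z hz => by
      have h1 := c.isCell_Iic.hasDerivWithinAt hw.differentiable hz
      have h2 := hw.neg_deriv_xL_zero hz
      rw [mul_zero, zero_mul, neg_eq_zero] at h2
      rwa [h2] at h1) hx self_mem_Iic
  have hR : ∀ x ∈ Ici (c.xR (Fin.last n)), w x = w (c.xR (Fin.last n)) := fun x hx =>
    (convex_Ici (c.xR (Fin.last n))).eq_of_hasDerivWithinAt_zero (fun z hz => by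
      have h1 := c.isCell_Ici.hasDerivWithinAt hw.differentiable hz
      have h2 := hw.deriv_xR_last hz
      rw [mul_zero, zero_mul] at h2
      rwa [h2] at h1) hx self_mem_Ici
  refine ⟨V, fun x hx => by simpa using hval j x hx, fun i hi x hx => by
    simpa [hi] using hval i x hx, fun x hx => (hd x hx).differentiableWithinAt,
    fun x hx => (hd' x hx).differentiableWithinAt,
    fun x hx => (hd' x hx).derivWithin (hu x hx), ?_⟩
  refine Asymptotics.IsBigO.of_bound (‖w (c.xL 0)‖ + ‖w (c.xR (Fin.last n))‖) ?_
  have hbdd : (Icc (c.xL 0) (c.xR (Fin.last n)))ᶜ ∈ Bornology.cobounded ℝ :=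
    Bornology.isBounded_def.1 (Metric.isBounded_Icc _ _)
  filter_upwards [hbdd] with x hx
  rw [mem_compl_iff, mem_Icc, not_and_or, not_le, not_le] at hx
  rw [norm_one, mul_one]
  rcases hx with hx | hx
  · rw [hVe _ (c.isCell_Iic.subset hx.le), hL x hx.le]
    exact (Complex.abs_re_le_norm _).trans (le_add_of_nonneg_right (norm_nonneg _))
  · rw [hVe _ (c.isCell_Ici.subset hx.le), hR x hx.le]
    exact (Complex.abs_re_le_norm _).trans (le_add_of_nonneg_left (norm_nonneg _))

variable (c)

lemma derivWithin_potential_xR (i j : Fin (n + 1)) :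
    ((derivWithin (c.potential j) c.exterior (c.xR i) : ℝ) : ℂ)
      = c.dtnMap 0 (indicatorTrace j) (.inr i) := by
  obtain ⟨h1, h2⟩ := (Classical.epsilon_spec (exists_isPotential (c := c) j)).isOuterSolution
  rw [← h1.deriv_xR c.nonresonant_zero i, h2 _ (c.xR_mem_exterior i)]
  rfl

lemma neg_derivWithin_potential_xL (i j : Fin (n + 1)) :
    -((derivWithin (c.potential j) c.exterior (c.xL i) : ℝ) : ℂ)
      = c.dtnMap 0 (indicatorTrace j) (.inl i) := by
  obtain ⟨h1, h2⟩ := (Classical.epsilon_spec (exists_isPotential (c := c) j)).isOuterSolution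
  rw [← h1.neg_deriv_xL c.nonresonant_zero i, h2 _ (c.xL_mem_exterior i)]
  rfl

end potential
end ResonatorChain

/-! ### Test functions and the integral identities of a solution -/

section testFunctions

/-- The solution of `w' - γ w = 1_{(-∞, x]}` with `w(a) = 0`, for `a ≤ x`. -/
noncomputable def stepSolution (γ a x y : ℝ) : ℝ :=
  (Real.exp (γ * (y - a)) - Real.exp (γ * (y - min x y))) / γ

lemma continuous_stepSolution (γ a x : ℝ) : Continuous (stepSolution γ a x) := by
  unfold stepSolution; fun_prop

lemma stepSolution_self {γ a x : ℝ} (h : a ≤ x) : stepSolution γ a x a = 0 := by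
  simp [stepSolution, min_eq_right h]

lemma hasDerivAt_stepSolution {γ : ℝ} (hγ : γ ≠ 0) (a : ℝ) {x y : ℝ} (hy : y ≠ x) :
    HasDerivAt (stepSolution γ a x)
      (γ * stepSolution γ a x y + {y | y ≤ x}.indicator (fun _ => 1) y) y := by
  have hexp (b : ℝ) : HasDerivAt (fun y => Real.exp (γ * (y - b))) (Real.exp (γ * (y - b)) * γ) y := by
    have : HasDerivAt (fun y => γ * (y - b)) γ y := by
      simpa using ((hasDerivAt_id y).sub_const b).const_mul γ
    exact this.exp
  rcases lt_or_gt_of_ne hy with h | h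
  · have e : stepSolution γ a x =ᶠ[𝓝 y] fun y => (Real.exp (γ * (y - a)) - 1) / γ := by
      filter_upwards [Iio_mem_nhds h] with z hz
      simp [stepSolution, min_eq_right (mem_Iio.1 hz).le]
    refine ((((hexp a).sub_const 1).div_const γ).congr_of_eventuallyEq e).congr_deriv ?_
    rw [e.eq_of_nhds, indicator_of_mem (show y ∈ {y | y ≤ x} from h.le)]
    field_simp; ring
  · have e : stepSolution γ a x =ᶠ[𝓝 y]
        fun y => (Real.exp (γ * (y - a)) - Real.exp (γ * (y - x))) / γ := by
      filter_upwards [Ioi_mem_nhds h] with z hz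
      simp [stepSolution, min_eq_left (mem_Ioi.1 hz).le]
    refine ((((hexp a).sub (hexp x)).div_const γ).congr_of_eventuallyEq e).congr_deriv ?_
    rw [e.eq_of_nhds, indicator_of_notMem (show y ∉ {y | y ≤ x} from not_le.2 h)]
    field_simp; ring

end testFunctions

namespace ResonatorChain
variable {N : ℕ} {c : ResonatorChain N}

lemma isPiece_exp (γ a b : ℝ) : IsPiece a b (fun x => ((Real.exp (γ * x) : ℝ) : ℂ))
    (fun x => ((γ * Real.exp (γ * x) : ℝ) : ℂ)) := by
  refine .of_hasDerivAt (fun x => HasDerivAt.ofReal_comp ?_) (by fun_prop)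
  have : HasDerivAt (fun x => γ * x) γ x := by simpa using (hasDerivAt_id x).const_mul γ
  exact this.exp.congr_deriv (mul_comm _ _)

lemma isPiece_stepSolution {γ : ℝ} (hγ : γ ≠ 0) (a b x : ℝ) :
    IsPiece a b (fun y => ((stepSolution γ a x y : ℝ) : ℂ))
      (fun y => ((γ * stepSolution γ a x y + {y | y ≤ x}.indicator (fun _ => 1) y : ℝ) : ℂ)) where
  continuousOn := (Complex.continuous_ofReal.comp (continuous_stepSolution γ a x)).continuousOn
  hasDerivAt := ⟨{x}, countable_singleton x, fun y hy =>
    (hasDerivAt_stepSolution hγ a hy.2).ofReal_comp⟩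
  memLp := by
    simp only [Complex.ofReal_add]
    refine MemLp.add (memLp_two_of_continuousOn (Continuous.continuousOn
      (Complex.continuous_ofReal.comp ((continuous_stepSolution γ a x).const_mul γ)))) ?_
    refine MemLp.of_bound (Measurable.aestronglyMeasurable ?_) 1 (.of_forall fun y => ?_)
    · exact Complex.measurable_ofReal.comp (measurable_const.indicator measurableSet_Iic)
    · rw [Complex.norm_real]
      exact (norm_indicator_le_norm_self _ _).trans (by simp)

/-- The form with a real test function that is supported on a single resonator. -/
lemma form_ofPieces_single {γ v vb : ℝ} {ω : ℂ} {δ : ℝ} (u : c.SobolevH1) (i : Fin N)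
    {φ φ' : ℝ → ℝ} (h : ∀ j, IsPiece (c.xL j) (c.xR j)
      ((Pi.single i fun x => (φ x : ℂ) : Fin N → ℝ → ℂ) j)
      ((Pi.single i fun x => (φ' x : ℂ) : Fin N → ℝ → ℂ) j)) :
    c.form γ v vb ω δ u (.ofPieces _ _ h) =
      (∫ x in c.xL i..c.xR i, u.weakDeriv x * (φ' x - γ * φ x : ℝ))
      + (∫ x in c.xL i..c.xR i, u.toFun x) * (∫ x in c.xL i..c.xR i, (φ x : ℂ))
      - (ω ^ 2 / vb ^ 2 * (∫ x in c.xL i..c.xR i, u.toFun x * φ x)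
        + δ * (φ (c.xR i) * c.dtn (ω / v) u.trace (.inr i)
          + φ (c.xL i) * c.dtn (ω / v) u.trace (.inl i))) := by
  have hz : ∀ j, j ≠ i → ∀ x ∈ Icc (c.xL j) (c.xR j),
      (SobolevH1.ofPieces _ _ h).toFun x = 0 ∧ (SobolevH1.ofPieces _ _ h).weakDeriv x = 0 := by
    intro j hj x hx
    rw [SobolevH1.ofPieces_toFun h hx, SobolevH1.ofPieces_weakDeriv h hx]
    simp [hj]
  have hi : ∀ x ∈ Icc (c.xL i) (c.xR i),
      (SobolevH1.ofPieces _ _ h).toFun x = φ x ∧ (SobolevH1.ofPieces _ _ h).weakDeriv x = φ' x := by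
    intro x hx
    rw [SobolevH1.ofPieces_toFun h hx, SobolevH1.ofPieces_weakDeriv h hx]
    simp
  set w := SobolevH1.ofPieces _ _ h
  have hle := c.left_le_right
  rw [form, Finset.sum_eq_single i, Finset.sum_eq_single i]
  · rw [(hi _ (left_mem_Icc.2 (hle i))).1, (hi _ (right_mem_Icc.2 (hle i))).1,
      ← intervalIntegral.integral_const_mul (ω ^ 2 / vb ^ 2 : ℂ) fun x => u.toFun x * φ x]
    congr 1
    · congr 1
      · refine intervalIntegral.integral_congr fun x hx => ?_
        rw [uIcc_of_le (hle i)] at hx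
        simp only [hi x hx, Complex.star_def, Complex.conj_ofReal]
        push_cast; ring
      · congr 1
        refine intervalIntegral.integral_congr fun x hx => ?_
        rw [uIcc_of_le (hle i)] at hx
        simp only [hi x hx, Complex.star_def, Complex.conj_ofReal]
    · congr 1
      · refine intervalIntegral.integral_congr fun x hx => ?_
        rw [uIcc_of_le (hle i)] at hx
        simp only [hi x hx, Complex.star_def, Complex.conj_ofReal]
        ring
      · simp only [Complex.star_def, Complex.conj_ofReal]
  · intro j _ hj
    rw [(hz j hj _ (left_mem_Icc.2 (hle j))).1, (hz j hj _ (right_mem_Icc.2 (hle j))).1,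
      intervalIntegral.integral_congr (g := fun _ => 0)]
    · simp
    · intro x hx
      rw [uIcc_of_le (hle j)] at hx
      simp [hz j hj x hx]
  · simp
  · intro j _ hj
    rw [intervalIntegral.integral_congr (g := fun _ => 0),
      intervalIntegral.integral_congr (f := fun x => star (w.toFun x)) (g := fun _ => 0)]
    · simp
    · intro x hx
      rw [uIcc_of_le (hle j)] at hx
      simp [hz j hj x hx]
    · intro x hx
      rw [uIcc_of_le (hle j)] at hx
      simp [hz j hj x hx]
  · simp

lemma isPiece_single {i : Fin N} {g g' : ℝ → ℂ} (h : IsPiece (c.xL i) (c.xR i) g g') (j : Fin N) :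
    IsPiece (c.xL j) (c.xR j) ((Pi.single i g : Fin N → ℝ → ℂ) j)
      ((Pi.single i g' : Fin N → ℝ → ℂ) j) := by
  by_cases hj : j = i
  · subst hj; simpa using h
  · simpa [hj] using IsPiece.zero _ _

lemma integral_ofPieces_single (F : Fin N → ℂ) {i : Fin N} {φ φ' : ℝ → ℝ}
    (h : ∀ j, IsPiece (c.xL j) (c.xR j)
      ((Pi.single i fun x => (φ x : ℂ) : Fin N → ℝ → ℂ) j)
      ((Pi.single i fun x => (φ' x : ℂ) : Fin N → ℝ → ℂ) j)) :
    ∑ j, F j * ∫ x in c.xL j..c.xR j, star ((SobolevH1.ofPieces _ _ h).toFun x)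
      = F i * ∫ x in c.xL i..c.xR i, (φ x : ℂ) := by
  rw [Finset.sum_eq_single i]
  · congr 1
    refine intervalIntegral.integral_congr fun x hx => ?_
    rw [uIcc_of_le (c.left_le_right i)] at hx
    simp [SobolevH1.ofPieces_toFun h hx]
  · intro j _ hj
    rw [intervalIntegral.integral_congr (g := fun _ => 0)]
    · simp
    · intro x hx
      rw [uIcc_of_le (c.left_le_right j)] at hx
      simp [SobolevH1.ofPieces_toFun h hx, hj]
  · simp

/-- The consequences of the variational equation `a(u, w) = ∑ᵢ Fᵢ ∫_{Dᵢ} w̄` that bound its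
solutions: `mean` comes from the test function `w(x) = exp (γ x)` on one resonator, for which
`w' - γ w = 0`, and `increment` from `w = stepSolution γ (xL i) x`. Here `κ = ω² / vb²`, and `T` is
the Dirichlet-to-Neumann map. -/
structure IsIntegralSolution (c : ResonatorChain N) (γ : ℝ) (κ : ℂ) (δ : ℝ)
    (T : (Fin N ⊕ Fin N → ℂ) →ₗ[ℂ] (Fin N ⊕ Fin N → ℂ)) (F : Fin N → ℂ) (u : ℝ → ℂ) : Prop where
  continuousOn : ∀ i, ContinuousOn u (Icc (c.xL i) (c.xR i))
  mean : ∀ i, ((∫ x in c.xL i..c.xR i, u x) - F i) * (∫ x in c.xL i..c.xR i, Real.exp (γ * x) : ℝ)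
    = κ * (∫ x in c.xL i..c.xR i, u x * Real.exp (γ * x))
      + δ * (Real.exp (γ * c.xR i) * T (Sum.elim (u ∘ c.xL) (u ∘ c.xR)) (.inr i)
        + Real.exp (γ * c.xL i) * T (Sum.elim (u ∘ c.xL) (u ∘ c.xR)) (.inl i))
  increment : ∀ i, ∀ x ∈ Icc (c.xL i) (c.xR i), u x - u (c.xL i)
    = (F i - ∫ x in c.xL i..c.xR i, u x) * (∫ y in c.xL i..c.xR i, (stepSolution γ (c.xL i) x y : ℂ))
      + κ * (∫ y in c.xL i..c.xR i, u y * stepSolution γ (c.xL i) x y)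
      + δ * (stepSolution γ (c.xL i) x (c.xR i) * T (Sum.elim (u ∘ c.xL) (u ∘ c.xR)) (.inr i))

/-- Every solution of the variational equation satisfies the two integral identities. -/
lemma isIntegralSolution_of_form_eq {γ v vb : ℝ} (hγ : γ ≠ 0) {ω : ℂ} {δ : ℝ}
    {T : (Fin N ⊕ Fin N → ℂ) →ₗ[ℂ] (Fin N ⊕ Fin N → ℂ)} {F : Fin N → ℂ} {u : c.SobolevH1}
    (hT : c.dtn (ω / v) u.trace = T u.trace)
    (h : ∀ w, c.form γ v vb ω δ u w = ∑ i, F i * ∫ x in c.xL i..c.xR i, star (w.toFun x)) :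
    c.IsIntegralSolution γ (ω ^ 2 / vb ^ 2) δ T F u.toFun where
  continuousOn := u.continuousOn
  mean i := by
    change _ = _ * _ + _ * (_ * T u.trace _ + _ * T u.trace _)
    have h1 := isPiece_single (isPiece_exp γ (c.xL i) (c.xR i))
    have h2 := h (.ofPieces _ _ h1)
    rw [integral_ofPieces_single, form_ofPieces_single, hT] at h2
    simp only [sub_self, Complex.ofReal_zero, mul_zero, intervalIntegral.integral_zero,
      zero_add] at h2
    rw [← intervalIntegral.integral_ofReal]
    linear_combination h2
  increment i x hx := by
    change _ = _ + _ + _ * (_ * T u.trace _)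
    have h1 := isPiece_single (isPiece_stepSolution hγ (c.xL i) (c.xR i) x)
    have h2 := h (.ofPieces _ _ h1)
    rw [integral_ofPieces_single, form_ofPieces_single, hT, stepSolution_self hx.1] at h2
    have h3 : ∫ y in c.xL i..c.xR i, u.weakDeriv y *
        ((γ * stepSolution γ (c.xL i) x y + {y | y ≤ x}.indicator (fun _ => 1) y)
          - γ * stepSolution γ (c.xL i) x y : ℝ) = u.toFun x - u.toFun (c.xL i) := by
      rw [← u.integral_weakDeriv i hx, ← intervalIntegral.integral_indicator hx]
      refine intervalIntegral.integral_congr fun y _ => ?_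
      by_cases hy : y ≤ x <;> simp [hy, indicator]
    rw [h3] at h2
    simp only [Complex.ofReal_zero, zero_mul, add_zero] at h2
    linear_combination h2

end ResonatorChain

/-! ### Uniform bounds -/

namespace ResonatorChain
variable {N : ℕ} {c : ResonatorChain N}

lemma integral_exp_pos (c : ResonatorChain N) (γ : ℝ) (i : Fin N) :
    0 < ∫ x in c.xL i..c.xR i, Real.exp (γ * x) :=
  intervalIntegral.intervalIntegral_pos_of_pos ((by fun_prop : Continuous _).intervalIntegrable _ _)
    (fun _ => Real.exp_pos _) (c.left_lt_right i)

section bounds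
variable {γ : ℝ} {κ : ℂ} {δ : ℝ} {T : (Fin N ⊕ Fin N → ℂ) →ₗ[ℂ] (Fin N ⊕ Fin N → ℂ)}
  {F F₁ F₂ : Fin N → ℂ} {u u₁ u₂ : ℝ → ℂ}

lemma IsIntegralSolution.sub (h₁ : c.IsIntegralSolution γ κ δ T F₁ u₁)
    (h₂ : c.IsIntegralSolution γ κ δ T F₂ u₂) :
    c.IsIntegralSolution γ κ δ T (F₁ - F₂) (u₁ - u₂) := by
  have htr : (Sum.elim ((u₁ - u₂) ∘ c.xL) ((u₁ - u₂) ∘ c.xR) : Fin N ⊕ Fin N → ℂ)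
      = Sum.elim (u₁ ∘ c.xL) (u₁ ∘ c.xR) - Sum.elim (u₂ ∘ c.xL) (u₂ ∘ c.xR) := by
    ext (i | i) <;> rfl
  have hint (i : Fin N) (φ : ℝ → ℝ) (hφ : Continuous φ) :
      ∫ x in c.xL i..c.xR i, (u₁ - u₂) x * φ x
        = (∫ x in c.xL i..c.xR i, u₁ x * φ x) - ∫ x in c.xL i..c.xR i, u₂ x * φ x := by
    have hφ' : ContinuousOn (fun x => (φ x : ℂ)) (Icc (c.xL i) (c.xR i)) :=
      (Complex.continuous_ofReal.comp hφ).continuousOn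
    simp only [Pi.sub_apply, sub_mul]
    exact intervalIntegral.integral_sub
      (ContinuousOn.intervalIntegrable_of_Icc (c.left_le_right i) ((h₁.continuousOn i).mul hφ'))
      (ContinuousOn.intervalIntegrable_of_Icc (c.left_le_right i) ((h₂.continuousOn i).mul hφ'))
  have hint1 (i : Fin N) : ∫ x in c.xL i..c.xR i, (u₁ - u₂) x
        = (∫ x in c.xL i..c.xR i, u₁ x) - ∫ x in c.xL i..c.xR i, u₂ x := by
    simpa using hint i (fun _ => 1) continuous_const
  refine ⟨fun i => (h₁.continuousOn i).sub (h₂.continuousOn i), fun i => ?_, fun i x hx => ?_⟩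
  · rw [hint1, hint i _ (by fun_prop), htr, map_sub]
    simp only [Pi.sub_apply]
    linear_combination h₁.mean i - h₂.mean i
  · rw [hint1, hint i _ (continuous_stepSolution _ _ _), htr, map_sub]
    simp only [Pi.sub_apply]
    linear_combination h₁.increment i x hx - h₂.increment i x hx

lemma norm_integral_le_of_le {f : ℝ → ℂ} {i : Fin N} {A : ℝ}
    (hf : ∀ x ∈ Icc (c.xL i) (c.xR i), ‖f x‖ ≤ A) : ‖∫ x in c.xL i..c.xR i, f x‖ ≤ A * c.len i := by
  have := intervalIntegral.norm_integral_le_of_norm_le_const (a := c.xL i) (b := c.xR i) (f := f)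
    (C := A) fun x hx => by
      rw [uIoc_of_le (c.left_le_right i)] at hx
      exact hf x (Ioc_subset_Icc_self hx)
  rwa [abs_of_nonneg (sub_nonneg.2 (c.left_le_right i))] at this

/-- A solution differs from the constant `F i / ℓ_i` on the `i`-th resonator only by a small multiple
of its own size. -/
lemma exists_local_bound (c : ResonatorChain N) (γ : ℝ) {B : ℝ} (hB : 0 ≤ B) (i : Fin N) :
    ∃ C, 0 ≤ C ∧ ∀ (κ : ℂ) (δ : ℝ) (T : (Fin N ⊕ Fin N → ℂ) →ₗ[ℂ] (Fin N ⊕ Fin N → ℂ))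
      (F : Fin N → ℂ) (u : ℝ → ℂ) (M : ℝ), c.IsIntegralSolution γ κ δ T F u →
      (∀ x ∈ Icc (c.xL i) (c.xR i), ‖u x‖ ≤ M) →
      (∀ e, ‖T (Sum.elim (u ∘ c.xL) (u ∘ c.xR)) e‖ ≤ B * M) →
      ∀ x ∈ Icc (c.xL i) (c.xR i), ‖u x - F i / c.len i‖ ≤ C * (‖κ‖ + |δ|) * M := by
  have hlen := c.len_pos i
  have hE := c.integral_exp_pos γ i
  have hL := left_mem_Icc.2 (c.left_le_right i)
  have hR := right_mem_Icc.2 (c.left_le_right i)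
  set E := ∫ x in c.xL i..c.xR i, Real.exp (γ * x)
  set ℓ := c.len i
  obtain ⟨G, hG⟩ := isCompact_Icc.exists_bound_of_continuousOn (s := Icc (c.xL i) (c.xR i))
    (f := fun x => ((Real.exp (γ * x) : ℝ) : ℂ)) (by fun_prop)
  obtain ⟨W, hW⟩ := (isCompact_Icc.prod isCompact_Icc).exists_bound_of_continuousOn
    (s := Icc (c.xL i) (c.xR i) ×ˢ Icc (c.xL i) (c.xR i))
    (f := fun z : ℝ × ℝ => ((stepSolution γ (c.xL i) z.1 z.2 : ℝ) : ℂ))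
    (by unfold stepSolution; fun_prop)
  have hG0 : 0 ≤ G := (norm_nonneg _).trans (hG _ hL)
  have hW0 : 0 ≤ W := (norm_nonneg _).trans (hW (_, _) ⟨hL, hL⟩)
  set C1 := (G * ℓ + 2 * G * B) / E with hC1
  set C2 := C1 * W * ℓ + W * ℓ + W * B with hC2
  have hC1' : 0 ≤ C1 := by positivity
  have hC2' : 0 ≤ C2 := by positivity
  refine ⟨2 * C2 + C1 / ℓ, by positivity, ?_⟩
  intro κ δ T F u M h hM hT
  have hM0 : 0 ≤ M := (norm_nonneg _).trans (hM _ hL)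
  set η := ‖κ‖ + |δ| with hη
  have hκη : ‖κ‖ ≤ η := le_add_of_nonneg_right (abs_nonneg _)
  have hδη : |δ| ≤ η := le_add_of_nonneg_left (norm_nonneg _)
  have hη0 : 0 ≤ η := by positivity
  have hmean : ‖(∫ x in c.xL i..c.xR i, u x) - F i‖ ≤ C1 * η * M := by
    have h1 : ‖∫ x in c.xL i..c.xR i, u x * Real.exp (γ * x)‖ ≤ M * G * ℓ :=
      norm_integral_le_of_le fun x hx => by
        rw [norm_mul]; exact mul_le_mul (hM x hx) (hG x hx) (norm_nonneg _) hM0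
    have h2 (y : ℝ) (hy : y ∈ Icc (c.xL i) (c.xR i)) (e) :
        ‖(Real.exp (γ * y) : ℂ) * T (Sum.elim (u ∘ c.xL) (u ∘ c.xR)) e‖ ≤ G * (B * M) := by
      rw [norm_mul]
      exact mul_le_mul (hG y hy) (hT e) (norm_nonneg _) hG0
    have h3 := congrArg norm (h.mean i)
    rw [norm_mul, Complex.norm_real, Real.norm_of_nonneg hE.le] at h3
    have h4 : ‖(∫ x in c.xL i..c.xR i, u x) - F i‖ * E ≤ η * (M * G * ℓ)
        + η * (G * (B * M) + G * (B * M)) := by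
      rw [h3]
      refine (norm_add_le _ _).trans (add_le_add ?_ ?_)
      · rw [norm_mul]; gcongr
      · rw [norm_mul, Complex.norm_real, Real.norm_eq_abs]
        gcongr
        exact (norm_add_le _ _).trans (add_le_add (h2 _ hR _) (h2 _ hL _))
    rw [hC1, ← le_div_iff₀ hE] at *
    refine h4.trans (le_of_eq ?_)
    ring
  have hincr : ∀ x ∈ Icc (c.xL i) (c.xR i), ‖u x - u (c.xL i)‖ ≤ C2 * η * M := by
    intro x hx
    have h1 : ‖∫ y in c.xL i..c.xR i, (stepSolution γ (c.xL i) x y : ℂ)‖ ≤ W * ℓ :=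
      norm_integral_le_of_le fun y hy => hW (x, y) ⟨hx, hy⟩
    have h2 : ‖∫ y in c.xL i..c.xR i, u y * stepSolution γ (c.xL i) x y‖ ≤ M * W * ℓ :=
      norm_integral_le_of_le fun y hy => by
        rw [norm_mul]; exact mul_le_mul (hM y hy) (hW (x, y) ⟨hx, hy⟩) (norm_nonneg _) hM0
    have h3 : ‖(stepSolution γ (c.xL i) x (c.xR i) : ℂ)
        * T (Sum.elim (u ∘ c.xL) (u ∘ c.xR)) (.inr i)‖ ≤ W * (B * M) := by
      rw [norm_mul]
      exact mul_le_mul (hW (x, _) ⟨hx, hR⟩) (hT _) (norm_nonneg _) hW0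
    rw [h.increment i x hx]
    calc _ ≤ C1 * η * M * (W * ℓ) + η * (M * W * ℓ) + η * (W * (B * M)) := by
          refine (norm_add₃_le).trans (add_le_add_three ?_ ?_ ?_)
          · rw [norm_mul, norm_sub_rev]; gcongr
          · rw [norm_mul]; gcongr
          · rw [norm_mul, Complex.norm_real, Real.norm_eq_abs]; gcongr
      _ = C2 * η * M := by rw [hC2]; ring
  intro x hx
  have hℓ : (ℓ : ℂ) ≠ 0 := Complex.ofReal_ne_zero.2 hlen.ne'
  have h1 : ‖∫ y in c.xL i..c.xR i, (u x - u y)‖ ≤ 2 * C2 * η * M * ℓ :=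
    norm_integral_le_of_le fun y hy => by
      calc ‖u x - u y‖ = ‖(u x - u (c.xL i)) - (u y - u (c.xL i))‖ := by congr 1; ring
        _ ≤ C2 * η * M + C2 * η * M := (norm_sub_le _ _).trans (add_le_add (hincr x hx) (hincr y hy))
        _ = 2 * C2 * η * M := by ring
  rw [intervalIntegral.integral_sub intervalIntegrable_const
    (ContinuousOn.intervalIntegrable_of_Icc (c.left_le_right i) (h.continuousOn i)),
    intervalIntegral.integral_const, Complex.real_smul] at h1
  have h2 : u x - F i / ℓ = ((((c.xR i - c.xL i : ℝ) : ℂ) * u x - ∫ y in c.xL i..c.xR i, u y)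
      + ((∫ y in c.xL i..c.xR i, u y) - F i)) / ℓ := by
    rw [show c.xR i - c.xL i = ℓ from rfl]
    field_simp; ring
  rw [h2, norm_div, Complex.norm_real, Real.norm_of_nonneg hlen.le, div_le_iff₀ hlen]
  refine (norm_add_le _ _).trans ((add_le_add h1 hmean).trans (le_of_eq ?_))
  field_simp

/-- Bounds for the solutions that are uniform in small `κ`, `δ`; they contain uniqueness
(`F = 0`). -/
lemma exists_uniform_bound (c : ResonatorChain N) (γ : ℝ) {B : ℝ} (hB : 0 ≤ B) :
    ∃ C, 0 < C ∧ ∀ (κ : ℂ) (δ : ℝ) (T : (Fin N ⊕ Fin N → ℂ) →ₗ[ℂ] (Fin N ⊕ Fin N → ℂ))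
      (F : Fin N → ℂ) (u : ℝ → ℂ), c.IsIntegralSolution γ κ δ T F u →
      (∀ f e, ‖T f e‖ ≤ B * ‖f‖) → C * (‖κ‖ + |δ|) ≤ 1 →
      ∀ i, ∀ x ∈ Icc (c.xL i) (c.xR i),
        ‖u x‖ ≤ C * ‖F‖ ∧ ‖u x - F i / c.len i‖ ≤ C * (‖κ‖ + |δ|) * ‖F‖ := by
  choose C hC hloc using c.exists_local_bound γ hB
  set C0 := ∑ i, C i
  set Λ := ∑ i, (c.len i)⁻¹
  have hC0 : 0 ≤ C0 := Finset.sum_nonneg fun i _ => hC i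
  have hΛ : 0 ≤ Λ := Finset.sum_nonneg fun i _ => (inv_pos.2 (c.len_pos i)).le
  refine ⟨1 + 2 * C0 + 2 * Λ + 2 * C0 * Λ, by positivity, ?_⟩
  intro κ δ T F u h hT hsmall i x hx
  set η := ‖κ‖ + |δ|
  have hη : 0 ≤ η := by positivity
  -- `M` is the maximum of `‖u‖` over all resonators; the local bounds control it by itself
  have hmax (i : Fin N) : ∃ x ∈ Icc (c.xL i) (c.xR i), ∀ y ∈ Icc (c.xL i) (c.xR i),
      ‖u y‖ ≤ ‖u x‖ :=
    isCompact_Icc.exists_isMaxOn (nonempty_Icc.2 (c.left_le_right i)) (h.continuousOn i).norm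
  choose m hm hmax using hmax
  have : Nonempty (Fin N) := ⟨i⟩
  obtain ⟨i₀, hi₀⟩ := Finite.exists_max fun i => ‖u (m i)‖
  set M := ‖u (m i₀)‖
  have hM : ∀ i, ∀ x ∈ Icc (c.xL i) (c.xR i), ‖u x‖ ≤ M := fun i x hx =>
    (hmax i x hx).trans (hi₀ i)
  have hM0 : 0 ≤ M := norm_nonneg _
  have htr : ‖(Sum.elim (u ∘ c.xL) (u ∘ c.xR) : Fin N ⊕ Fin N → ℂ)‖ ≤ M := by
    refine (pi_norm_le_iff_of_nonneg hM0).2 ?_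
    rintro (j | j)
    · exact hM j _ (left_mem_Icc.2 (c.left_le_right j))
    · exact hM j _ (right_mem_Icc.2 (c.left_le_right j))
  have hTM (e) : ‖T (Sum.elim (u ∘ c.xL) (u ∘ c.xR)) e‖ ≤ B * M :=
    (hT _ e).trans (mul_le_mul_of_nonneg_left htr hB)
  have hest : ∀ i, ∀ x ∈ Icc (c.xL i) (c.xR i), ‖u x - F i / c.len i‖ ≤ C0 * η * M := by
    intro i x hx
    refine (hloc i κ δ T F u M h (hM i) hTM x hx).trans ?_
    have : C i ≤ C0 := Finset.single_le_sum (fun i _ => hC i) (Finset.mem_univ i)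
    gcongr
  have hF : ∀ i, ‖F i / c.len i‖ ≤ Λ * ‖F‖ := by
    intro i
    rw [norm_div, Complex.norm_real, Real.norm_of_nonneg (c.len_pos i).le, div_eq_inv_mul]
    have : (c.len i)⁻¹ ≤ Λ := Finset.single_le_sum (f := fun i => (c.len i)⁻¹)
      (fun i _ => (inv_pos.2 (c.len_pos i)).le) (Finset.mem_univ i)
    exact mul_le_mul this (norm_le_pi_norm F i) (norm_nonneg _) hΛ
  have hself : M ≤ Λ * ‖F‖ + C0 * η * M := by
    calc M = ‖F i₀ / c.len i₀ + (u (m i₀) - F i₀ / c.len i₀)‖ := by rw [add_sub_cancel]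
      _ ≤ _ := (norm_add_le _ _).trans (add_le_add (hF i₀) (hest i₀ _ (hm i₀)))
  have hhalf : C0 * η ≤ 1 / 2 := by
    have : 2 * C0 * η ≤ (1 + 2 * C0 + 2 * Λ + 2 * C0 * Λ) * η := by
      gcongr
      nlinarith [mul_nonneg hC0 hΛ]
    linarith
  have hM2 : M ≤ 2 * Λ * ‖F‖ := by nlinarith
  have hF0 := norm_nonneg F
  refine ⟨(hM i x hx).trans (hM2.trans ?_), (hest i x hx).trans ?_⟩
  · gcongr
    nlinarith [mul_nonneg hC0 hΛ]
  · calc C0 * η * M ≤ C0 * η * (2 * Λ * ‖F‖) := by gcongr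
      _ = (2 * C0 * Λ) * η * ‖F‖ := by ring
      _ ≤ _ := by gcongr; nlinarith

end bounds
end ResonatorChain

/-! ### Existence -/

section fundamentalSystem

/-- Three functions `e k` with first and second derivatives `e' k`, `e'' k` that are linearly
independent on every interval and satisfy `-(e k)'' - γ (e k)' - κ e k = lam k` for constants
`lam k`. -/
structure IsFundamentalSystem (γ : ℝ) (κ : ℂ) (e e' e'' : Fin 3 → ℝ → ℂ) (lam : Fin 3 → ℂ) :
    Prop where
  contDiff : ∀ k, ContDiff ℝ (⊤ : ℕ∞) (e' k)
  hasDerivAt : ∀ k x, HasDerivAt (e k) (e' k x) x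
  hasDerivAt' : ∀ k x, HasDerivAt (e' k) (e'' k x) x
  ode : ∀ k x, e'' k x + γ * e' k x + κ * e k x = -lam k
  linearIndependent : ∀ (a : Fin 3 → ℂ) (p q : ℝ), p < q →
    (∀ x ∈ Icc p q, ∑ k, a k * e k x = 0) → a = 0

lemma hasDerivAt_cexp_mul (r : ℂ) (x : ℝ) :
    HasDerivAt (fun x : ℝ => Complex.exp (r * x)) (r * Complex.exp (r * x)) x :=
  (hasDerivAt_ofReal_mul r x).cexp.congr_deriv (mul_comm _ _)

lemma deriv_eq_zero_of_eqOn_Ioo {f f' : ℝ → ℂ} {p q : ℝ} (hd : ∀ x, HasDerivAt f (f' x) x)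
    (h : ∀ x ∈ Ioo p q, f x = 0) : ∀ x ∈ Ioo p q, f' x = 0 := by
  intro x hx
  have e : f =ᶠ[𝓝 x] fun _ => 0 := by
    filter_upwards [Ioo_mem_nhds hx.1 hx.2] with y hy using h y hy
  rw [← (hd x).deriv, e.deriv_eq, deriv_const]

/-- Two exponentials and an affine function form such a system, as long as the roots of
`r² + γ r + κ = 0` are distinct. -/
lemma exists_isFundamentalSystem {γ : ℝ} (hγ : γ ≠ 0) {κ : ℂ} (hκ : 4 * κ ≠ γ ^ 2) :
    ∃ e e' e'' lam, IsFundamentalSystem γ κ e e' e'' lam := by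
  have hγ' : (γ : ℂ) ≠ 0 := Complex.ofReal_ne_zero.2 hγ
  obtain ⟨s, hs⟩ : ∃ s : ℂ, γ ^ 2 - 4 * κ = s ^ 2 :=
    (IsAlgClosed.exists_pow_nat_eq (γ ^ 2 - 4 * κ : ℂ) two_pos).imp fun _ h => h.symm
  -- the affine member `α + β x` of the system: constant unless `κ = 0`
  obtain ⟨α, β, hβ, hne⟩ : ∃ α β : ℂ, κ * β = 0 ∧ γ * β + κ * α ≠ 0 := by
    rcases eq_or_ne κ 0 with rfl | h
    · exact ⟨0, 1, by simp, by simpa using hγ'⟩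
    · exact ⟨1, 0, by simp, by simpa using h⟩
  have hs0 : s ≠ 0 := by
    rintro rfl
    exact hκ (by linear_combination -hs)
  set r₁ := (-γ + s) / 2 with hr₁
  set r₂ := (-γ - s) / 2 with hr₂
  have e₁ : r₁ ^ 2 + γ * r₁ + κ = 0 := by rw [hr₁]; linear_combination -(1 / 4) * hs
  have e₂ : r₂ ^ 2 + γ * r₂ + κ = 0 := by rw [hr₂]; linear_combination -(1 / 4) * hs
  have hsub : r₁ - r₂ = s := by rw [hr₁, hr₂]; ring
  let e : Fin 3 → ℝ → ℂ :=
    ![fun x => Complex.exp (r₁ * x), fun x => Complex.exp (r₂ * x), fun x => α + β * x]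
  let e' : Fin 3 → ℝ → ℂ :=
    ![fun x => r₁ * Complex.exp (r₁ * x), fun x => r₂ * Complex.exp (r₂ * x), fun _ => β]
  let e'' : Fin 3 → ℝ → ℂ :=
    ![fun x => r₁ * (r₁ * Complex.exp (r₁ * x)), fun x => r₂ * (r₂ * Complex.exp (r₂ * x)),
      fun _ => 0]
  have hd : ∀ k x, HasDerivAt (e k) (e' k x) x := by
    intro k x
    fin_cases k
    · exact hasDerivAt_cexp_mul r₁ x
    · exact hasDerivAt_cexp_mul r₂ x
    · exact (hasDerivAt_ofReal_mul β x).const_add α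
  have hd' : ∀ k x, HasDerivAt (e' k) (e'' k x) x := by
    intro k x
    fin_cases k
    · exact (hasDerivAt_cexp_mul r₁ x).const_mul r₁
    · exact (hasDerivAt_cexp_mul r₂ x).const_mul r₂
    · exact hasDerivAt_const x β
  have hode : ∀ k x, e'' k x + γ * e' k x + κ * e k x = -(![0, 0, -(γ * β + κ * α)] : Fin 3 → ℂ) k := by
    intro k x
    fin_cases k
    · simp only [e, e', e'', Fin.zero_eta, Matrix.cons_val_zero]
      linear_combination Complex.exp (r₁ * x) * e₁
    · simp only [e, e', e'', Fin.mk_one, Matrix.cons_val_one, Matrix.cons_val_zero]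
      linear_combination Complex.exp (r₂ * x) * e₂
    · simp only [e, e', e'', Fin.reduceFinMk, Matrix.cons_val]
      linear_combination (x : ℂ) * hβ
  refine ⟨e, e', e'', ![0, 0, -(γ * β + κ * α)], ⟨?_, hd, hd', hode, ?_⟩⟩
  · have hc (r : ℂ) : ContDiff ℝ (⊤ : ℕ∞) (fun x : ℝ => r * Complex.exp (r * x)) :=
      contDiff_const.mul (contDiff_const.mul Complex.ofRealCLM.contDiff).cexp
    intro k
    fin_cases k
    exacts [hc r₁, hc r₂, contDiff_const]
  · intro a p q hpq h
    have hsum (f f' : Fin 3 → ℝ → ℂ) (hf : ∀ k x, HasDerivAt (f k) (f' k x) x) (x : ℝ) :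
        HasDerivAt (fun x => ∑ k, a k * f k x) (∑ k, a k * f' k x) x :=
      HasDerivAt.fun_sum fun k _ => (hf k x).const_mul (a k)
    have h0 : ∀ x ∈ Ioo p q, ∑ k, a k * e k x = 0 := fun x hx => h x (Ioo_subset_Icc_self hx)
    have h1 := deriv_eq_zero_of_eqOn_Ioo (hsum e e' hd) h0
    have h2 := deriv_eq_zero_of_eqOn_Ioo (hsum e' e'' hd') h1
    obtain ⟨x, hx⟩ := nonempty_Ioo.2 hpq
    specialize h0 x hx; specialize h1 x hx; specialize h2 x hx
    have h3 : a 2 * (γ * β + κ * α) = 0 := by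
      have k0 := hode 0 x
      have k1 := hode 1 x
      have k2 := hode 2 x
      simp only [Fin.sum_univ_three, Matrix.cons_val] at h0 h1 h2 k0 k1 k2
      linear_combination h2 + γ * h1 + κ * h0 - a 0 * k0 - a 1 * k1 - a 2 * k2
    have ha2 : a 2 = 0 := (mul_eq_zero.1 h3).resolve_right hne
    simp only [Fin.sum_univ_three, ha2, e, e', Matrix.cons_val, zero_mul, add_zero] at h0 h1
    have ha0 : a 0 * s * Complex.exp (r₁ * x) = 0 := by
      rw [← hsub]; linear_combination h1 - r₂ * h0
    have ha1 : a 1 * s * Complex.exp (r₂ * x) = 0 := by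
      rw [← hsub]; linear_combination r₁ * h0 - h1
    have ha0' : a 0 = 0 := by simpa [hs0] using ha0
    have ha1' : a 1 = 0 := by simpa [hs0] using ha1
    ext k
    fin_cases k
    exacts [ha0', ha1', ha2]

end fundamentalSystem

namespace ResonatorChain
variable {N : ℕ} {c : ResonatorChain N}

lemma intervalIntegral_star (f : ℝ → ℂ) (a b : ℝ) :
    ∫ x in a..b, star (f x) = star (∫ x in a..b, f x) := by
  simp only [intervalIntegral, Complex.star_def, integral_conj, map_sub]

/-- Integration by parts for the form, when `u` is a classical solution of
`-u'' - γ u' - (ω² / vb²) u = lam i` on each resonator. -/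
lemma form_eq_of_ode {γ v vb : ℝ} {ω : ℂ} {δ : ℝ} {u : c.SobolevH1} {g g' g'' : Fin N → ℝ → ℂ}
    {lam : Fin N → ℂ} (hu : ∀ i, ∀ x ∈ Icc (c.xL i) (c.xR i), u.toFun x = g i x)
    (hu' : ∀ i, ∀ x ∈ Icc (c.xL i) (c.xR i), u.weakDeriv x = g' i x)
    (hc : ∀ i, ContDiff ℝ (⊤ : ℕ∞) (g' i)) (hd : ∀ i x, HasDerivAt (g' i) (g'' i x) x)
    (hode : ∀ i x, g'' i x + γ * g' i x + ω ^ 2 / vb ^ 2 * g i x = -lam i) (w : c.SobolevH1) :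
    c.form γ v vb ω δ u w = ∑ i,
      (((∫ x in c.xL i..c.xR i, g i x) + lam i) * (∫ x in c.xL i..c.xR i, star (w.toFun x))
      + (g' i (c.xR i) - δ * c.dtn (ω / v) u.trace (.inr i)) * star (w.toFun (c.xR i))
      + (-g' i (c.xL i) - δ * c.dtn (ω / v) u.trace (.inl i)) * star (w.toFun (c.xL i))) := by
  rw [form, ← Finset.sum_sub_distrib]
  refine Finset.sum_congr rfl fun i _ => ?_
  have hle := c.left_le_right i
  have hw : ContinuousOn (fun x => star (w.toFun x)) (Icc (c.xL i) (c.xR i)) :=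
    (w.continuousOn i).star
  have hwI : IntervalIntegrable (fun x => star (w.toFun x)) volume (c.xL i) (c.xR i) :=
    hw.intervalIntegrable_of_Icc hle
  have hg'' : Continuous (g'' i) := by
    rw [show g'' i = deriv (g' i) from funext fun x => (hd i x).deriv.symm]
    exact (hc i).continuous_deriv (by simp)
  have hmain : ∫ x in c.xL i..c.xR i, g' i x * star (w.weakDeriv x)
      = g' i (c.xR i) * star (w.toFun (c.xR i)) - g' i (c.xL i) * star (w.toFun (c.xL i))
        - ∫ x in c.xL i..c.xR i, g'' i x * star (w.toFun x) := by
    have := congrArg star (w.integral_mul_weakDeriv i le_rfl hle le_rfl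
      (φ := fun x => star (g' i x)) (φ' := fun x => star (g'' i x))
      (Complex.conjCLE.contDiff.comp (hc i)) (fun x => (hd i x).star))
    simp only [star_sub, star_mul', star_star, ← intervalIntegral_star] at this
    exact this
  have hI1 : IntervalIntegrable (fun x => g' i x * star (w.weakDeriv x)) volume
      (c.xL i) (c.xR i) := by
    refine IntervalIntegrable.continuousOn_mul ?_ (hc i).continuous.continuousOn
    have := w.intervalIntegrable_weakDeriv i
    rw [intervalIntegrable_iff] at this ⊢
    exact Complex.conjCLE.toContinuousLinearMap.integrable_comp this
  have hI2 (f : ℝ → ℂ) (hf : ContinuousOn f (Icc (c.xL i) (c.xR i))) :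
      IntervalIntegrable (fun x => f x * star (w.toFun x)) volume (c.xL i) (c.xR i) :=
    (hf.mul hw).intervalIntegrable_of_Icc hle
  have hgc : ContinuousOn (g i) (Icc (c.xL i) (c.xR i)) :=
    (u.continuousOn i).congr fun x hx => (hu i x hx).symm
  have s1 : ∫ x in c.xL i..c.xR i,
      (u.weakDeriv x * star (w.weakDeriv x) - γ * u.weakDeriv x * star (w.toFun x))
      = (∫ x in c.xL i..c.xR i, g' i x * star (w.weakDeriv x))
        - γ * ∫ x in c.xL i..c.xR i, g' i x * star (w.toFun x) := by
    rw [← intervalIntegral.integral_const_mul, ← intervalIntegral.integral_sub hI1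
      ((hI2 _ (hc i).continuous.continuousOn).const_mul _)]
    refine intervalIntegral.integral_congr fun x hx => ?_
    rw [uIcc_of_le hle] at hx
    simp only [hu' i x hx]; ring
  have s2 : ∫ x in c.xL i..c.xR i, u.toFun x = ∫ x in c.xL i..c.xR i, g i x :=
    intervalIntegral.integral_congr fun x hx => by
      rw [uIcc_of_le hle] at hx
      exact hu i x hx
  have s3 : ∫ x in c.xL i..c.xR i, ω ^ 2 / vb ^ 2 * u.toFun x * star (w.toFun x)
      = ω ^ 2 / vb ^ 2 * ∫ x in c.xL i..c.xR i, g i x * star (w.toFun x) := by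
    rw [← intervalIntegral.integral_const_mul]
    refine intervalIntegral.integral_congr fun x hx => ?_
    rw [uIcc_of_le hle] at hx
    simp only [hu i x hx]; ring
  have s4 : (∫ x in c.xL i..c.xR i, g'' i x * star (w.toFun x))
      + γ * (∫ x in c.xL i..c.xR i, g' i x * star (w.toFun x))
      + ω ^ 2 / vb ^ 2 * (∫ x in c.xL i..c.xR i, g i x * star (w.toFun x))
      = -lam i * ∫ x in c.xL i..c.xR i, star (w.toFun x) := by
    rw [← intervalIntegral.integral_const_mul, ← intervalIntegral.integral_const_mul,
      ← intervalIntegral.integral_const_mul, ← intervalIntegral.integral_add (hI2 _ hg''.continuousOn)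
      ((hI2 _ (hc i).continuous.continuousOn).const_mul _), ← intervalIntegral.integral_add
      ((hI2 _ hg''.continuousOn).add ((hI2 _ (hc i).continuous.continuousOn).const_mul _))
      ((hI2 _ hgc).const_mul _)]
    refine intervalIntegral.integral_congr fun x _ => ?_
    rw [← hode i x]; ring
  rw [s1, s2, s3, hmain]
  linear_combination -s4

section existence
variable {γ v vb : ℝ} {ω : ℂ} {δ : ℝ} {T : (Fin N ⊕ Fin N → ℂ) →ₗ[ℂ] (Fin N ⊕ Fin N → ℂ)}

/-- Uniqueness for the homogeneous problem implies solvability: on each resonator the ansatz space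
has dimension three, and so has the space of conditions, which are the differential equation with the
prescribed constant and the two boundary conditions. -/
lemma exists_form_eq (hγ : γ ≠ 0) (hω : 4 * (ω ^ 2 / vb ^ 2) ≠ (γ : ℂ) ^ 2)
    (hT : ∀ f, c.dtn (ω / v) f = T f)
    (huniq : ∀ u : c.SobolevH1, (∀ w, c.form γ v vb ω δ u w = 0) →
      ∀ i, ∀ x ∈ Icc (c.xL i) (c.xR i), u.toFun x = 0) (F : Fin N → ℂ) :
    ∃ u : c.SobolevH1, ∀ w, c.form γ v vb ω δ u w
      = ∑ i, F i * ∫ x in c.xL i..c.xR i, star (w.toFun x) := by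
  obtain ⟨e, e', e'', lam, he⟩ := exists_isFundamentalSystem hγ hω
  let P (f : Fin 3 → ℝ → ℂ) (a : Fin N → Fin 3 → ℂ) (i : Fin N) (x : ℝ) : ℂ := ∑ k, a i k * f k x
  have hP (f f' : Fin 3 → ℝ → ℂ) (hf : ∀ k x, HasDerivAt (f k) (f' k x) x) (a) (i) (x : ℝ) :
      HasDerivAt (P f a i) (P f' a i x) x :=
    HasDerivAt.fun_sum fun k _ => (hf k x).const_mul (a i k)
  have hPc (a) (i) : ContDiff ℝ (⊤ : ℕ∞) (P e' a i) :=
    ContDiff.sum fun k _ => contDiff_const.mul (he.contDiff k)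
  have hpiece (a) (i) : IsPiece (c.xL i) (c.xR i) (P e a i) (P e' a i) :=
    .of_hasDerivAt (hP e e' he.hasDerivAt a i) (hPc a i).continuous
  let U (a : Fin N → Fin 3 → ℂ) : c.SobolevH1 := .ofPieces (P e a) (P e' a) (hpiece a)
  have hU (a) : ∀ i, ∀ x ∈ Icc (c.xL i) (c.xR i), (U a).toFun x = P e a i x := fun i x hx =>
    SobolevH1.ofPieces_toFun _ hx
  have hPadd (f) (a b) (i) (x) : P f (a + b) i x = P f a i x + P f b i x := by
    simp [P, add_mul, Finset.sum_add_distrib]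
  have hPsmul (f) (z : ℂ) (a) (i) (x) : P f (z • a) i x = z * P f a i x := by
    simp [P, Finset.mul_sum, mul_assoc]
  have hcontP (a) (i) : Continuous (P e a i) :=
    continuous_iff_continuousAt.2 fun x => (hP e e' he.hasDerivAt a i x).continuousAt
  let tr : (Fin N → Fin 3 → ℂ) →ₗ[ℂ] (Fin N ⊕ Fin N → ℂ) :=
    { toFun := fun a => Sum.elim (fun i => P e a i (c.xL i)) (fun i => P e a i (c.xR i))
      map_add' := fun a b => by ext (i | i) <;> simp [hPadd]
      map_smul' := fun z a => by ext (i | i) <;> simp [hPsmul] }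
  have htr (a) : (U a).trace = tr a := by
    ext (i | i)
    · exact hU a i _ (left_mem_Icc.2 (c.left_le_right i))
    · exact hU a i _ (right_mem_Icc.2 (c.left_le_right i))
  -- the three conditions per resonator: the constant in the equation and the two boundary conditions
  let Ψ : (Fin N → Fin 3 → ℂ) →ₗ[ℂ] (Fin N → Fin 3 → ℂ) :=
    { toFun := fun a i => ![(∫ x in c.xL i..c.xR i, P e a i x) + ∑ k, a i k * lam k,
        P e' a i (c.xR i) - δ * T (tr a) (.inr i), -P e' a i (c.xL i) - δ * T (tr a) (.inl i)]
      map_add' := fun a b => by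
        ext i k
        fin_cases k
        · simp only [hPadd, Fin.zero_eta, Matrix.cons_val_zero, Pi.add_apply, add_mul,
            Finset.sum_add_distrib]
          rw [intervalIntegral.integral_add ((hcontP a i).intervalIntegrable _ _)
            ((hcontP b i).intervalIntegrable _ _)]
          ring
        · simp [hPadd]; ring
        · simp [hPadd]; ring
      map_smul' := fun z a => by
        ext i k
        fin_cases k
        · simp [hPsmul, mul_add, Finset.mul_sum, mul_assoc]
        · simp [hPsmul]; ring
        · simp [hPsmul]; ring }
  have hform (a) (w) : c.form γ v vb ω δ (U a) w = ∑ i,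
      (Ψ a i 0 * (∫ x in c.xL i..c.xR i, star (w.toFun x))
      + Ψ a i 1 * star (w.toFun (c.xR i)) + Ψ a i 2 * star (w.toFun (c.xL i))) := by
    rw [form_eq_of_ode (lam := fun i => ∑ k, a i k * lam k) (hU a)
      (fun i x hx => SobolevH1.ofPieces_weakDeriv _ hx) (hPc a) (hP e' e'' he.hasDerivAt' a),
      hT, htr]
    · rfl
    · intro i x
      simp only [P, Finset.mul_sum, ← Finset.sum_add_distrib, ← Finset.sum_neg_distrib]
      refine Finset.sum_congr rfl fun k _ => ?_
      linear_combination a i k * he.ode k x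
  have hinj : Function.Injective Ψ := by
    rw [← LinearMap.ker_eq_bot, LinearMap.ker_eq_bot']
    intro a ha
    have h0 := huniq (U a) fun w => by rw [hform, ha]; simp
    ext1 i
    exact he.linearIndependent (a i) _ _ (c.left_lt_right i) fun x hx => by
      rw [← h0 i x hx, hU a i x hx]
  obtain ⟨a, ha⟩ := LinearMap.injective_iff_surjective.1 hinj fun i => ![F i, 0, 0]
  exact ⟨U a, fun w => by rw [hform, ha]; simp⟩

end existence
end ResonatorChain

/-! ### The expansion -/

namespace ResonatorChain

section expansion
variable {n : ℕ} {c : ResonatorChain (n + 1)} {γ : ℝ} {κ k : ℂ} {δ : ℝ} {u : ℝ → ℂ}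

lemma ofReal_gaugeCapacitance (c : ResonatorChain (n + 1)) (γ : ℝ) (i j : Fin (n + 1)) :
    (c.gaugeCapacitance γ i j : ℂ) = -(c.len i / (∫ x in c.xL i..c.xR i, Real.exp (γ * x) : ℝ)) *
      (Real.exp (γ * c.xR i) * c.dtnMap 0 (indicatorTrace j) (.inr i)
        + Real.exp (γ * c.xL i) * c.dtnMap 0 (indicatorTrace j) (.inl i)) := by
  rw [← derivWithin_potential_xR, ← neg_derivWithin_potential_xL, gaugeCapacitance, Matrix.of_apply]
  push_cast
  rfl

/-- The expansion of the mean values of a solution: on the right-hand side of the identity `mean`,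
the solution may be replaced by `1 / ℓ_j` times the indicator function of the `j`-th resonator and
the Dirichlet-to-Neumann map by the one for `k = 0`. -/
lemma IsIntegralSolution.norm_integral_sub_le {j : Fin (n + 1)} {B C G η : ℝ} (hB : 0 ≤ B)
    (hC : 0 ≤ C) (hη : 0 ≤ η)
    (h : c.IsIntegralSolution γ κ δ (c.dtnMap k) (Pi.single j 1) u)
    (hT : ∀ f e, ‖c.dtnMap k f e - c.dtnMap 0 f e‖ ≤ B * ‖k‖ * ‖f‖)
    (hT0 : ∀ f e, ‖c.dtnMap 0 f e‖ ≤ B * ‖f‖)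
    (hu : ∀ i, ∀ x ∈ Icc (c.xL i) (c.xR i),
      ‖u x‖ ≤ C ∧ ‖u x - (Pi.single j 1 : Fin (n + 1) → ℂ) i / c.len i‖ ≤ C * η)
    {i : Fin (n + 1)} (hG : ∀ x ∈ Icc (c.xL i) (c.xR i), ‖((Real.exp (γ * x) : ℝ) : ℂ)‖ ≤ G) :
    ‖(∫ x in c.xL i..c.xR i, u x) - ((Pi.single j 1 : Fin (n + 1) → ℂ) i
      - δ * (c.gaugeCapacitance γ i j / (c.len i * c.len j)))‖
    ≤ (‖κ‖ * (C * G * c.len i) + |δ| * (2 * (G * (B * ‖k‖ * C + B * (C * η)))))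
      / ∫ x in c.xL i..c.xR i, Real.exp (γ * x) := by
  have hE := c.integral_exp_pos γ i
  have hmean := h.mean i
  have hcap := c.ofReal_gaugeCapacitance γ i j
  have hL := left_mem_Icc.2 (c.left_le_right i)
  have hR := right_mem_Icc.2 (c.left_le_right i)
  set E := ∫ x in c.xL i..c.xR i, Real.exp (γ * x)
  set t : Fin (n + 1) ⊕ Fin (n + 1) → ℂ := Sum.elim (u ∘ c.xL) (u ∘ c.xR)
  have hEc : (E : ℂ) ≠ 0 := Complex.ofReal_ne_zero.2 hE.ne'
  have hi : (c.len i : ℂ) ≠ 0 := Complex.ofReal_ne_zero.2 (c.len_pos i).ne'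
  have hj : (c.len j : ℂ) ≠ 0 := Complex.ofReal_ne_zero.2 (c.len_pos j).ne'
  set t₀ : Fin (n + 1) ⊕ Fin (n + 1) → ℂ := (c.len j : ℂ)⁻¹ • indicatorTrace j with ht₀
  have hG0 : 0 ≤ G := (norm_nonneg _).trans (hG _ hL)
  have hsingle (l : Fin (n + 1)) : (c.len j : ℂ)⁻¹ * (Pi.single j 1 : Fin (n + 1) → ℂ) l
      = (Pi.single j 1 : Fin (n + 1) → ℂ) l / c.len l := by
    by_cases hl : l = j
    · subst hl; simp
    · simp [hl]
  have ht : ‖t‖ ≤ C := (pi_norm_le_iff_of_nonneg hC).2 (by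
    rintro (l | l)
    · exact (hu l _ (left_mem_Icc.2 (c.left_le_right l))).1
    · exact (hu l _ (right_mem_Icc.2 (c.left_le_right l))).1)
  have htt : ‖t - t₀‖ ≤ C * η := (pi_norm_le_iff_of_nonneg (by positivity)).2 (by
    rintro (l | l)
    · simpa [t, t₀, indicatorTrace, hsingle] using (hu l _ (left_mem_Icc.2 (c.left_le_right l))).2
    · simpa [t, t₀, indicatorTrace, hsingle] using (hu l _ (right_mem_Icc.2 (c.left_le_right l))).2)
  have hdiff (e) : ‖c.dtnMap k t e - c.dtnMap 0 t₀ e‖ ≤ B * ‖k‖ * C + B * (C * η) := by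
    calc ‖c.dtnMap k t e - c.dtnMap 0 t₀ e‖
        = ‖(c.dtnMap k t e - c.dtnMap 0 t e) + c.dtnMap 0 (t - t₀) e‖ := by
          rw [map_sub, Pi.sub_apply, sub_add_sub_cancel]
      _ ≤ B * ‖k‖ * ‖t‖ + B * ‖t - t₀‖ := (norm_add_le _ _).trans (add_le_add (hT _ _) (hT0 _ _))
      _ ≤ _ := by gcongr
  have h0 (e) : c.dtnMap 0 t₀ e = (c.len j : ℂ)⁻¹ * c.dtnMap 0 (indicatorTrace j) e := by
    rw [ht₀, map_smul, Pi.smul_apply, smul_eq_mul]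
  have hid : ((∫ x in c.xL i..c.xR i, u x) - ((Pi.single j 1 : Fin (n + 1) → ℂ) i
      - δ * (c.gaugeCapacitance γ i j / (c.len i * c.len j)))) * E
      = κ * (∫ x in c.xL i..c.xR i, u x * Real.exp (γ * x))
        + δ * (Real.exp (γ * c.xR i) * (c.dtnMap k t (.inr i) - c.dtnMap 0 t₀ (.inr i))
          + Real.exp (γ * c.xL i) * (c.dtnMap k t (.inl i) - c.dtnMap 0 t₀ (.inl i))) := by
    have hcap' : (c.gaugeCapacitance γ i j / (c.len i * c.len j) : ℂ) * E
        = -(Real.exp (γ * c.xR i) * c.dtnMap 0 t₀ (.inr i)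
          + Real.exp (γ * c.xL i) * c.dtnMap 0 t₀ (.inl i)) := by
      rw [hcap, h0, h0]
      field_simp
    linear_combination hmean + δ * hcap'
  have hI : ‖∫ x in c.xL i..c.xR i, u x * Real.exp (γ * x)‖ ≤ C * G * c.len i :=
    norm_integral_le_of_le fun x hx => by
      rw [norm_mul]; exact mul_le_mul (hu i x hx).1 (hG x hx) (norm_nonneg _) hC
  have hb {y : ℝ} (hy : y ∈ Icc (c.xL i) (c.xR i)) (e) :
      ‖(Real.exp (γ * y) : ℂ) * (c.dtnMap k t e - c.dtnMap 0 t₀ e)‖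
        ≤ G * (B * ‖k‖ * C + B * (C * η)) := by
    rw [norm_mul]
    exact mul_le_mul (hG y hy) (hdiff e) (norm_nonneg _) hG0
  rw [le_div_iff₀ hE]
  have h1 := congrArg norm hid
  rw [norm_mul, Complex.norm_real, Real.norm_of_nonneg hE.le] at h1
  rw [h1]
  refine (norm_add_le _ _).trans (add_le_add ?_ ?_)
  · rw [norm_mul]; gcongr
  · rw [norm_mul, Complex.norm_real, Real.norm_eq_abs]
    gcongr
    exact (norm_add_le _ _).trans ((add_le_add (hb hR _) (hb hL _)).trans (le_of_eq (by ring)))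

lemma inv_volumeMatrix {N : ℕ} (c : ResonatorChain N) :
    (c.volumeMatrix)⁻¹ = Matrix.diagonal fun i => (c.len i : ℂ)⁻¹ := by
  refine Matrix.inv_eq_right_inv ?_
  rw [volumeMatrix, Matrix.diagonal_mul_diagonal, ← Matrix.diagonal_one]
  congr 1
  ext i
  exact mul_inv_cancel₀ (Complex.ofReal_ne_zero.2 (c.len_pos i).ne')

end expansion
end ResonatorChain

open ResonatorChain in
theorem mainTheorem3 {N : ℕ} (c : ResonatorChain N) (γ v vb : ℝ) (hγ : γ ≠ 0) (hv : 0 < v)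
    (hvb : 0 < vb) :
    ∃ ε > 0, ∃ K : ℝ, ∀ (ω : ℂ) (δ : ℝ), ‖ω‖ < ε → |δ| < ε →
      ∃ h : Fin N → c.SobolevH1,
        (∀ j, c.IsBasisFunction γ v vb ω δ j (h j)) ∧
        (∀ j (u : c.SobolevH1), c.IsBasisFunction γ v vb ω δ j u →
          ∀ i, Set.EqOn u.toFun (h j).toFun (Set.Icc (c.xL i) (c.xR i))) ∧
        ∀ i j,
          ‖(c.integralMatrix h -
              (1 + (ω ^ 2 / (vb : ℂ) ^ 2) • (c.volumeMatrix)⁻¹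
                - (δ : ℂ) • ((c.volumeMatrix)⁻¹ * (c.gaugeCapacitance γ).map Complex.ofReal
                    * (c.volumeMatrix)⁻¹))) i j‖
            ≤ K * (‖ω‖ + |δ|) ^ 2 := by
  rcases N with _ | n
  · exact ⟨1, one_pos, 0, fun ω δ _ _ => ⟨fun j => j.elim0, fun j => j.elim0, fun j => j.elim0,
      fun i => i.elim0⟩⟩
  obtain ⟨B, hB, hdtn⟩ := c.exists_dtn_bounds
  obtain ⟨ε₁, hε₁, hdtn⟩ := Metric.eventually_nhds_iff.1 hdtn
  obtain ⟨C, hC, hbound⟩ := c.exists_uniform_bound γ hB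
  have hG (i : Fin (n + 1)) := isCompact_Icc.exists_bound_of_continuousOn
    (s := Icc (c.xL i) (c.xR i)) (f := fun x => ((Real.exp (γ * x) : ℝ) : ℂ)) (by fun_prop)
  choose G hG using hG
  have hG0 (i) : 0 ≤ G i := (norm_nonneg _).trans (hG i _ (left_mem_Icc.2 (c.left_le_right i)))
  -- `‖κ‖ + |δ| ≤ a (‖ω‖ + |δ|)` for `‖ω‖ ≤ 1`
  set a := 1 + 1 / vb ^ 2 with ha
  have ha0 : 0 < a := by positivity
  let K₀ (i : Fin (n + 1)) : ℝ := (a * (C * G i * c.len i)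
    + 2 * (G i * (B * (1 / v) * C + B * (C * a)))) / (∫ x in c.xL i..c.xR i, Real.exp (γ * x))
    + a * (c.len i)⁻¹
  have hK₀ (i) : 0 ≤ K₀ i := by
    have h1 := c.integral_exp_pos γ i
    have h2 := c.len_pos i
    have h3 := hG0 i
    positivity
  -- the bounds on `ω` keep `ω / v` in the domain of the estimates for the Dirichlet-to-Neumann map,
  -- `4 ‖κ‖ < γ²`, and, with the bound on `δ`, `C (‖κ‖ + |δ|) ≤ 1`
  refine ⟨min (min 1 (ε₁ * v)) (min (γ ^ 2 / (4 * a)) (1 / (2 * a * C))), by positivity,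
    ∑ i, K₀ i, fun ω δ hω hδ => ?_⟩
  simp only [lt_min_iff] at hω hδ
  obtain ⟨⟨hω1, hωv⟩, hωγ, hωC⟩ := hω
  obtain ⟨-, -, hδC⟩ := hδ
  set κ : ℂ := ω ^ 2 / vb ^ 2 with hκ
  set k : ℂ := ω / v with hk
  have hkn : ‖k‖ = 1 / v * ‖ω‖ := by
    rw [hk, norm_div, Complex.norm_real, Real.norm_of_nonneg hv.le]; ring
  have hκn : ‖κ‖ ≤ a * ‖ω‖ ^ 2 := by
    rw [hκ, norm_div, norm_pow, norm_pow, Complex.norm_real, Real.norm_of_nonneg hvb.le, ha]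
    have : 0 ≤ ‖ω‖ ^ 2 := by positivity
    calc ‖ω‖ ^ 2 / vb ^ 2 = 0 + 1 / vb ^ 2 * ‖ω‖ ^ 2 := by ring
      _ ≤ _ := by rw [add_mul, one_mul]; gcongr
  have hω0 := norm_nonneg ω
  have hδ0 := abs_nonneg δ
  have hκn' : ‖κ‖ ≤ a * ‖ω‖ := hκn.trans (by gcongr; nlinarith)
  have ha1 : 1 ≤ a := le_add_of_nonneg_right (by positivity)
  have hη : ‖κ‖ + |δ| ≤ a * (‖ω‖ + |δ|) := by nlinarith
  have hsmall : C * (‖κ‖ + |δ|) ≤ 1 := by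
    have h1 : ‖ω‖ * (2 * a * C) < 1 := (lt_div_iff₀ (by positivity)).1 hωC
    have h2 : |δ| * (2 * a * C) < 1 := (lt_div_iff₀ (by positivity)).1 hδC
    calc C * (‖κ‖ + |δ|) ≤ C * (a * (‖ω‖ + |δ|)) := by gcongr
      _ ≤ 1 := by linarith
  have hκγ : 4 * κ ≠ (γ : ℂ) ^ 2 := by
    intro h
    have h1 : ‖ω‖ * (4 * a) < γ ^ 2 := (lt_div_iff₀ (by positivity)).1 hωγ
    have h2 := congrArg norm h
    rw [norm_mul, norm_pow, Complex.norm_real, Real.norm_eq_abs, sq_abs, Complex.norm_ofNat] at h2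
    linarith
  have hdtnk := hdtn (y := k) (by
    rw [dist_zero_right, hkn, one_div_mul_eq_div, div_lt_iff₀ hv]; exact hωv)
  have hdtn0 := hdtn (y := 0) (by simpa using hε₁)
  have hTB : ∀ f e, ‖c.dtnMap k f e‖ ≤ B * ‖f‖ := fun f => (hdtnk f).2.1
  have hsol {F : Fin (n + 1) → ℂ} {u : c.SobolevH1}
      (hu : ∀ w, c.form γ v vb ω δ u w = ∑ i, F i * ∫ x in c.xL i..c.xR i, star (w.toFun x)) :
      c.IsIntegralSolution γ κ δ (c.dtnMap k) F u.toFun :=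
    isIntegralSolution_of_form_eq hγ (hdtnk _).1 hu
  have hrhs (j : Fin (n + 1)) (w : c.SobolevH1) :
      ∑ i, (Pi.single j 1 : Fin (n + 1) → ℂ) i * ∫ x in c.xL i..c.xR i, star (w.toFun x)
        = ∫ x in c.xL j..c.xR j, star (w.toFun x) := by
    rw [Finset.sum_eq_single j (fun i _ hi => by simp [hi]) (by simp)]
    simp
  have hex (j : Fin (n + 1)) := exists_form_eq (c := c) (δ := δ) (vb := vb) (v := v) hγ hκγ
    (fun f => (hdtnk f).1)
    (fun u hu i x hx => by
      have h1 := (hbound κ δ _ 0 _ (hsol (F := 0) (u := u) (by simpa using hu)) hTB hsmall i x hx).1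
      rwa [norm_zero, mul_zero, norm_le_zero_iff] at h1)
    (Pi.single j 1)
  choose h hh using hex
  refine ⟨h, fun j w => (hh j w).trans (hrhs j w), fun j u hu i x hx => ?_, fun i j => ?_⟩
  · have h1 := (hsol (F := Pi.single j 1) fun w => (hu w).trans (hrhs j w).symm).sub (hsol (hh j))
    have h2 := (hbound κ δ _ _ _ h1 hTB hsmall i x hx).1
    rwa [sub_self, norm_zero, mul_zero, norm_le_zero_iff, Pi.sub_apply, sub_eq_zero] at h2
  · have hF : ‖(Pi.single j 1 : Fin (n + 1) → ℂ)‖ ≤ 1 := (pi_norm_le_iff_of_nonneg zero_le_one).2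
      fun l => by by_cases hl : l = j <;> simp [hl]
    have h1 := IsIntegralSolution.norm_integral_sub_le (η := ‖κ‖ + |δ|) hB hC.le (by positivity)
      (hsol (hh j))
      (fun f => (hdtnk f).2.2) (fun f => (hdtn0 f).2.1)
      (fun i x hx => by
        obtain ⟨b1, b2⟩ := hbound κ δ _ _ _ (hsol (hh j)) hTB hsmall i x hx
        exact ⟨b1.trans (mul_le_of_le_one_right hC.le hF),
          b2.trans (mul_le_of_le_one_right (by positivity) hF)⟩) (hG i)
    have hentry : (c.integralMatrix h -
        (1 + κ • (c.volumeMatrix)⁻¹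
          - (δ : ℂ) • ((c.volumeMatrix)⁻¹ * (c.gaugeCapacitance γ).map Complex.ofReal
            * (c.volumeMatrix)⁻¹))) i j
        = ((∫ x in c.xL i..c.xR i, (h j).toFun x) - ((Pi.single j 1 : Fin (n + 1) → ℂ) i
          - δ * (c.gaugeCapacitance γ i j / (c.len i * c.len j))))
          - κ * (Matrix.diagonal fun i => (c.len i : ℂ)⁻¹ : Matrix _ _ ℂ) i j := by
      rw [inv_volumeMatrix]
      simp only [integralMatrix, Matrix.sub_apply, Matrix.add_apply, Matrix.smul_apply,
        Matrix.of_apply, Matrix.mul_diagonal, Matrix.diagonal_mul, Matrix.map_apply, smul_eq_mul,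
        Matrix.one_apply, Pi.single_apply]
      rw [div_eq_mul_inv, mul_inv]
      ring
    rw [hentry]
    have hdiag : ‖(Matrix.diagonal fun i => (c.len i : ℂ)⁻¹ : Matrix _ _ ℂ) i j‖ ≤ (c.len i)⁻¹ := by
      have := (inv_pos.2 (c.len_pos i)).le
      rw [Matrix.diagonal_apply]
      split_ifs
      · rw [norm_inv, Complex.norm_real, Real.norm_of_nonneg (c.len_pos i).le]
      · rwa [norm_zero]
    have hE := c.integral_exp_pos γ i
    have hlen := c.len_pos i
    have hGi := hG0 i
    set r := ‖ω‖ + |δ| with hr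
    have hωr : ‖ω‖ ≤ r := le_add_of_nonneg_right hδ0
    have hδr : |δ| ≤ r := le_add_of_nonneg_left hω0
    have hr0 : 0 ≤ r := by positivity
    have hκr : ‖κ‖ ≤ a * r ^ 2 := hκn.trans (by gcongr)
    calc _ ≤ _ := norm_sub_le _ _
      _ ≤ (a * r ^ 2 * (C * G i * c.len i)
          + r * (2 * (G i * (B * (1 / v * r) * C + B * (C * (a * r))))))
            / (∫ x in c.xL i..c.xR i, Real.exp (γ * x)) + a * r ^ 2 * (c.len i)⁻¹ := by
        refine add_le_add (h1.trans ?_) ?_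
        · rw [hkn]
          gcongr
        · rw [norm_mul]; gcongr
      _ = K₀ i * r ^ 2 := by simp only [K₀]; ring
      _ ≤ _ := by
        gcongr
        exact Finset.single_le_sum (fun i _ => hK₀ i) (Finset.mem_univ i)
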